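/- Let $d\in\{2,3\}$, let $N\ge 0$ be an integer and let $\sigma\in\mathbb R$. Let $\widehat D=\{x\in\mathbb R^d: x_i>-1 \text{ for all } i,\ \sum_i (x_i+1)<2\}$ be the bi-unit reference triangle or tetrahedron. An element is a set $D=\Phi(\widehat D)$, where $\Phi$ is an invertible affine map of $\mathbb R^d$; put $h=\operatorname{diam}(D)$ and call $D$ quasi-regular with constant $\sigma$ if $D$ contains a ball of radius $r>0$ with $h\le\sigma r$. For $m\ge 0$ let $P^m(D)$ be the space of real polynomials of total degree at most $m$ on $D$, and write $(f,g)=\int_D fg\,dx$. The norms are $\|f\|_{W^{s,2}(D)}=\bigl(\sum_{|\alpha|\le s}\|D^\alpha f\|_{L^2(D)}^2\bigr)^{1/2}$ and $\|f\|_{W^{s,\infty}(D)}=\max_{|\alpha|\le s}\|D^\alpha f\|_{L^\infty(D)}$, with weak derivatives $D^\alpha$. For a weight $w$ with $0<w_{\min}\le w\le w_{\max}<\infty$ almost everywhere on $D$ and $u\in L^2(D)$, $T_{1/w}^{-1}u$ denotes the polynomial in $P^N(D)$ with $\bigl(\tfrac1w\,T_{1/w}^{-1}u,q\bigr)=(u,q)$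 for all $q\in P^N(D)$. There is a constant $C>0$, depending only on $d$, $N$ and $\sigma$, such that for every element $D$ that is quasi-regular with constant $\sigma$, every $u\in W^{N+1,2}(D)$, every $w\in W^{N+1,\infty}(D)$ with $0<w_{\min}\le w\le w_{\max}<\infty$ almost everywhere on $D$ for some constants $w_{\min},w_{\max}$, the polynomial $T_{1/w}^{-1}u$ exists and is unique, and for all $0\le M\le N$ and $v\in P^M(D)$, $$\bigl|(wu,v)-(T_{1/w}^{-1}u,v)\bigr|\le C\,h^{2N+2-M}\,\|w\|_{L^\infty(D)}\,\Bigl\|\frac1w\Bigr\|_{L^\infty(D)}^2\,\|w\|_{W^{N+1,\infty}(D)}^2\,\|u\|_{W^{N+1,2}(D)}\,\|v\|_{L^\infty(D)}.$$ In particular (the case $M=0$, $v=1$), the local conservation error satisfies $$\bigl|(wu,1)-(T_{1/w}^{-1}u,1)\bigr|\le C\,h^{2N+2}\,\|w\|_{L^\infty(D)}\,\Bigl\|\frac1w\Bigr\|_{L^\infty(D)}^2\,\|w\|_{W^{N+1,\infty}(D)}^2\,\|u\|_{W^{N+1,2}(D)}.$$ -/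

import Mathlib

noncomputable section

namespace WADG

open MeasureTheory
open scoped ContDiff ENNReal

/-- Physical space of dimension `d` with its Euclidean norm. -/
abbrev Space (d : ℕ) : Type := EuclideanSpace ℝ (Fin d)

/-- The (open) bi-unit reference simplex: its vertices are `(-1, …, -1)` and the points that
are obtained from it by changing one coordinate to `1`.  For `d = 2, 3` this is the bi-unit
triangle and tetrahedron. -/
def refSimplex (d : ℕ) : Set (Space d) :=
  {x | (∀ i, -1 < x i) ∧ ∑ i, (x i + 1) < 2}

/-- The affinely mapped element `D = Φ (D̂)`. -/
def element {d : ℕ} (Φ : Space d ≃ᵃ[ℝ] Space d) : Set (Space d) :=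
  Φ '' refSimplex d

/-- Quasi-regularity with constant `σ`: the diameter of `D` is at most `σ` times the
radius of some ball that is contained in `D`. -/
def IsQuasiRegular {d : ℕ} (σ : ℝ) (D : Set (Space d)) : Prop :=
  ∃ c r, 0 < r ∧ Metric.ball c r ⊆ D ∧ Metric.diam D ≤ σ * r

/-- The function on space given by a polynomial in the coordinates. -/
def polyFun {d : ℕ} (p : MvPolynomial (Fin d) ℝ) : Space d → ℝ :=
  fun x => MvPolynomial.eval (fun i => x i) p

/-- The classical partial derivative in the `i`-th coordinate direction. -/
def partialDeriv {d : ℕ} (i : Fin d) (f : Space d → ℝ) : Space d → ℝ :=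
  fun x => fderiv ℝ f x (EuclideanSpace.single i 1)

/-- The classical derivative `∂₁^{α₁} ⋯ ∂_d^{α_d} f`. -/
def multiDeriv {d : ℕ} (α : Fin d → ℕ) (f : Space d → ℝ) : Space d → ℝ :=
  (List.finRange d).foldr (fun i g => (partialDeriv i)^[α i] g) f

/-- `g` is the weak derivative `D^α u` on the open set `D`. -/
def HasWeakDeriv {d : ℕ} (D : Set (Space d)) (α : Fin d → ℕ) (u g : Space d → ℝ) : Prop :=
  LocallyIntegrableOn u D ∧ LocallyIntegrableOn g D ∧
    ∀ φ : Space d → ℝ, ContDiff ℝ ∞ φ → HasCompactSupport φ → tsupport φ ⊆ D →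
      ∫ x in D, u x * multiDeriv α φ x = (-1) ^ (∑ i, α i) * ∫ x in D, g x * φ x

open Classical in
/-- A representative of the weak derivative `D^α u` on `D` (which is unique almost everywhere
in `D`), and `0` if there is none. -/
def weakDeriv {d : ℕ} (D : Set (Space d)) (α : Fin d → ℕ) (u : Space d → ℝ) : Space d → ℝ :=
  if h : ∃ g, HasWeakDeriv D α u g then h.choose else 0

/-- The multi-indices `α` with `|α| ≤ s`. -/
def multiIndices (d s : ℕ) : Finset (Fin d → ℕ) :=
  (Fintype.piFinset fun _ => Finset.range (s + 1)).filter fun α => ∑ i, α i ≤ s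

/-- The Sobolev space `W^{s,p}(D)`. -/
def MemSobolev {d : ℕ} (D : Set (Space d)) (s : ℕ) (p : ℝ≥0∞) (u : Space d → ℝ) : Prop :=
  MemLp u p (volume.restrict D) ∧
    ∀ α ∈ multiIndices d s, ∃ g, HasWeakDeriv D α u g ∧ MemLp g p (volume.restrict D)

/-- The norm of `L^p(D)`. -/
def lpNorm {d : ℕ} (D : Set (Space d)) (p : ℝ≥0∞) (u : Space d → ℝ) : ℝ :=
  (eLpNorm u p (volume.restrict D)).toReal

/-- The extended-real norm of `W^{s,p}(D)`: the `ℓ^p` sum (the maximum if `p = ∞`) of the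
`L^p(D)` norms of the weak derivatives of order at most `s`. -/
def sobolevENorm {d : ℕ} (D : Set (Space d)) (s : ℕ) (p : ℝ≥0∞) (u : Space d → ℝ) : ℝ≥0∞ :=
  if p = ⊤ then
    (multiIndices d s).sup fun α => eLpNorm (weakDeriv D α u) ⊤ (volume.restrict D)
  else
    (∑ α ∈ multiIndices d s,
      eLpNorm (weakDeriv D α u) p (volume.restrict D) ^ p.toReal) ^ (1 / p.toReal)

/-- The norm of `W^{s,p}(D)`. -/
def sobolevNorm {d : ℕ} (D : Set (Space d)) (s : ℕ) (p : ℝ≥0∞) (u : Space d → ℝ) : ℝ :=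
  (sobolevENorm D s p u).toReal

/-- The inner product of `L²(D)`. -/
def l2Inner {d : ℕ} (D : Set (Space d)) (f g : Space d → ℝ) : ℝ :=
  ∫ x in D, f x * g x

/-- `p = T_w⁻¹ u`, that is, `p ∈ P^N` and `(w p, q) = (u, q)` for every `q ∈ P^N`. -/
def IsTInv {d : ℕ} (D : Set (Space d)) (N : ℕ) (w u : Space d → ℝ)
    (p : MvPolynomial (Fin d) ℝ) : Prop :=
  p.totalDegree ≤ N ∧ ∀ q : MvPolynomial (Fin d) ℝ, q.totalDegree ≤ N →
    l2Inner D (fun x => w x * polyFun p x) (polyFun q) = l2Inner D u (polyFun q)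

open Classical in
/-- The operator `T_w⁻¹ : L²(D) → P^N(D)` (with value `0` where it is not defined). -/
def tInv {d : ℕ} (D : Set (Space d)) (N : ℕ) (w u : Space d → ℝ) : MvPolynomial (Fin d) ℝ :=
  if h : ∃ p, IsTInv D N w u p then h.choose else 0

/-- The weight-adjusted inner product `(T_{1/w}⁻¹ u, v)`, as a function of `w`. -/
def weightAdjustedInner {d : ℕ} (D : Set (Space d)) (N : ℕ) (w u v : Space d → ℝ) : ℝ :=
  l2Inner D (polyFun (tInv D N (fun x => 1 / w x) u)) v

end WADG

end

noncomputable section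

namespace WADG

open MeasureTheory Filter Topology
open scoped ContDiff ENNReal

/-! ### Polynomial functions -/

/-! Put a = 1/w, let P be the weighted projection of u, and let r = u - aP be its residual, which is
L²-orthogonal to all polynomials of degree at most N. Since aw = 1, wu - P = wr, so the error
against v equals ∫ r w v. For every q with deg q + deg v ≤ N the polynomial qv is invisible to r,
and the error becomes ∫ r v (w - q): a product of two small factors (`abs_weightAdjusted_error_le`).

The first factor is quasi-optimal: ‖r‖ ≤ ‖a‖_∞ ‖wu - p‖ for every p of degree at most N
(`lpNorm_residual_le`), hence of order h^(N+1). The second factor ‖w - q‖ with deg q ≤ N - M is of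
order h^(N-M+1). Together they give h^(2N+2-M). For h ≥ 1 the choice p = q = 0 suffices, because
√|D| is then dominated by that power of h. The factor ‖w‖_∞‖1/w‖_∞ ≥ 1 brings the bound to its final
form (`abs_error_le`).

Both approximation results rest on a Bramble-Hilbert estimate for convex sets. For smooth g the
Taylor polynomials at y ∈ D are averaged over y, and some base point is at least as good as the
average (`exists_polyFun_approx_smooth`); convexity alone yields the constant 2^d. Sobolev functions
are mollified on convex inner sets exhausting D. The approximating polynomials stay bounded in a
finite-dimensional space, so a subsequence converges, and Fatou's lemma carries the estimate to the
limit (`exists_polyFun_approx_of_tendsto`). For wu the product of the two mollifications is used, so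
only the classical Leibniz rule enters. -/

theorem polyFun_mul {d : ℕ} (p q : MvPolynomial (Fin d) ℝ) (x : Space d) :
    polyFun (p * q) x = polyFun p x * polyFun q x := by
  simp [polyFun]

theorem polyFun_one {d : ℕ} : polyFun (1 : MvPolynomial (Fin d) ℝ) = fun _ => 1 := by
  funext x
  simp [polyFun]

theorem polyFun_zero {d : ℕ} : polyFun (0 : MvPolynomial (Fin d) ℝ) = fun _ => 0 := by
  funext x
  simp [polyFun]

theorem continuous_polyFun {d : ℕ} (p : MvPolynomial (Fin d) ℝ) : Continuous (polyFun p) := by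
  unfold polyFun
  exact (MvPolynomial.continuous_eval p).comp (by fun_prop)

/-- The linear functional `p ↦ p(x)`. -/
def evalLinear {d : ℕ} (x : Space d) : MvPolynomial (Fin d) ℝ →ₗ[ℝ] ℝ :=
  (MvPolynomial.aeval (fun i => x i)).toLinearMap

theorem evalLinear_apply {d : ℕ} (x : Space d) (p : MvPolynomial (Fin d) ℝ) :
    evalLinear x p = polyFun p x := by
  simp [evalLinear, polyFun, MvPolynomial.aeval_eq_eval]

theorem memLp_of_continuous {d : ℕ} {D : Set (Space d)} (hb : Bornology.IsBounded D)
    {f : Space d → ℝ} (hf : Continuous f) (q : ℝ≥0∞) : MemLp f q (volume.restrict D) := by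
  have hc : IsCompact (closure D) := hb.isCompact_closure
  obtain ⟨C, hC⟩ := hc.exists_bound_of_continuousOn hf.continuousOn
  have h1 : MemLp f q (volume.restrict (closure D)) := by
    have : IsFiniteMeasure (volume.restrict (closure D)) :=
      ⟨by simpa using hc.measure_lt_top⟩
    refine MemLp.of_bound hf.aestronglyMeasurable C ?_
    exact (ae_restrict_iff' isClosed_closure.measurableSet).2 (Eventually.of_forall hC)
  exact h1.mono_measure (Measure.restrict_mono subset_closure le_rfl)

theorem eq_zero_of_ae_polyFun_eq_zero {d : ℕ} {D : Set (Space d)} (ho : IsOpen D)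
    (hne : D.Nonempty) {p : MvPolynomial (Fin d) ℝ}
    (hp : ∀ᵐ x ∂(volume.restrict D), polyFun p x = 0) : p = 0 := by
  have h1 : Set.EqOn (polyFun p) (fun _ => 0) D :=
    Measure.eqOn_open_of_ae_eq hp ho (continuous_polyFun p).continuousOn continuousOn_const
  obtain ⟨c, hc⟩ := hne
  let e : Space d ≃L[ℝ] (Fin d → ℝ) := EuclideanSpace.equiv (Fin d) ℝ
  have ho' : IsOpen (e.symm ⁻¹' D) := ho.preimage e.symm.continuous
  have hc' : e c ∈ e.symm ⁻¹' D := by simpa using hc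
  obtain ⟨ε, hε, hball⟩ := Metric.isOpen_iff.1 ho' _ hc'
  -- A sup-norm ball is a box of intervals, and a polynomial vanishing on a product of infinite sets
  -- is zero; hence the passage from the Euclidean norm to the product norm.
  refine MvPolynomial.funext_set (fun i => Metric.ball (e c i) ε) (fun i => ?_) (fun x hx => ?_)
  · rw [Real.ball_eq_Ioo]
    exact Set.Ioo_infinite (by linarith)
  · have hx' : x ∈ Metric.ball (e c) ε := by
      rw [ball_pi _ hε]
      exact hx
    have := h1 (hball hx')
    rw [map_zero]
    exact this

/-- The `L²(B)` class of the polynomial function of `p`. -/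
def polyLp {d : ℕ} {B : Set (Space d)} (hb : Bornology.IsBounded B) :
    MvPolynomial (Fin d) ℝ →ₗ[ℝ] Lp ℝ 2 (volume.restrict B) where
  toFun p := (memLp_of_continuous hb (continuous_polyFun p) 2).toLp
  map_add' p q := by
    rw [← MemLp.toLp_add]
    congr 1
    funext x
    simp [polyFun]
  map_smul' c p := by
    rw [RingHom.id_apply, ← MemLp.toLp_const_smul]
    congr 1
    funext x
    simp [polyFun, MvPolynomial.smul_eval]

/-- An injective linear map from a finite-dimensional space is antilipschitz, so an L²(B) bound
controls the coefficients and Bolzano-Weierstrass applies. Evaluation at a point is linear in the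
coefficients, hence continuous, so convergence holds at every point of space and not only in B. -/
theorem exists_subseq_tendsto_polyFun {d m : ℕ} {B : Set (Space d)} (ho : IsOpen B)
    (hne : B.Nonempty) (hb : Bornology.IsBounded B) {p : ℕ → MvPolynomial (Fin d) ℝ}
    (hp : ∀ n, (p n).totalDegree ≤ m) {K : ℝ≥0∞} (hK : K ≠ ⊤)
    (hpK : ∀ n, eLpNorm (polyFun (p n)) 2 (volume.restrict B) ≤ K) :
    ∃ q : MvPolynomial (Fin d) ℝ, q.totalDegree ≤ m ∧ ∃ φ : ℕ → ℕ, StrictMono φ ∧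
      ∀ x, Tendsto (fun n => polyFun (p (φ n)) x) atTop (𝓝 (polyFun q x)) := by
  let V := MvPolynomial.restrictTotalDegree (Fin d) ℝ m
  let e : V ≃ₗ[ℝ] (Fin (Module.finrank ℝ V) → ℝ) := (Module.finBasis ℝ V).equivFun
  let L : (Fin (Module.finrank ℝ V) → ℝ) →ₗ[ℝ] Lp ℝ 2 (volume.restrict B) :=
    (polyLp hb).comp (V.subtype.comp e.symm.toLinearMap)
  have hker : L.ker = ⊥ := by
    rw [LinearMap.ker_eq_bot']
    intro a ha
    have h1 : polyLp hb (e.symm a : MvPolynomial (Fin d) ℝ) = 0 := ha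
    have h2 : polyFun (e.symm a : MvPolynomial (Fin d) ℝ) =ᵐ[volume.restrict B] 0 :=
      (MemLp.toLp_eq_toLp_iff (memLp_of_continuous hb (continuous_polyFun _) 2)
        (MemLp.zero (p := 2))).1 h1
    have h3 := eq_zero_of_ae_polyFun_eq_zero ho hne h2
    have h4 : e.symm a = 0 := Subtype.ext h3
    simpa using h4
  obtain ⟨c, -, hc⟩ := L.exists_antilipschitzWith hker
  let a : ℕ → (Fin (Module.finrank ℝ V) → ℝ) := fun n =>
    e ⟨p n, (MvPolynomial.mem_restrictTotalDegree _ _ _).2 (hp n)⟩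
  have hLa : ∀ n, ‖L (a n)‖ ≤ K.toReal := by
    intro n
    have : L (a n) = polyLp hb (p n) := by simp [L, a]
    rw [this]
    change ‖(memLp_of_continuous hb (continuous_polyFun (p n)) 2).toLp‖ ≤ _
    rw [Lp.norm_toLp]
    exact ENNReal.toReal_mono hK (hpK n)
  have hbd : ∀ n, a n ∈ Metric.closedBall 0 (c * K.toReal) := by
    intro n
    have h1 := hc.le_mul_dist (a n) 0
    rw [mem_closedBall_zero_iff]
    simp only [map_zero, dist_zero_right] at h1
    exact h1.trans (mul_le_mul_of_nonneg_left (hLa n) c.2)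
  obtain ⟨b, -, φ, hφ, hlim⟩ := tendsto_subseq_of_bounded Metric.isBounded_closedBall hbd
  refine ⟨e.symm b, (MvPolynomial.mem_restrictTotalDegree _ _ _).1 (e.symm b).2, φ, hφ,
    fun x => ?_⟩
  let ev : (Fin (Module.finrank ℝ V) → ℝ) →ₗ[ℝ] ℝ :=
    (evalLinear x).comp (V.subtype.comp e.symm.toLinearMap)
  have hev : Continuous ev := ev.continuous_of_finiteDimensional
  have h1 := (hev.tendsto b).comp hlim
  have h2 : ev b = polyFun (e.symm b : MvPolynomial (Fin d) ℝ) x := evalLinear_apply _ _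
  rw [← h2]
  refine h1.congr fun n => ?_
  have : ev (a (φ n)) = evalLinear x (p (φ n)) := by simp [ev, a]
  rw [← evalLinear_apply, ← this]
  rfl

/-- The polynomial `x ↦ A (x - y, …, x - y)` associated with a multilinear form `A`. -/
theorem exists_polyFun_eq_multilinear {d k : ℕ}
    (A : ContinuousMultilinearMap ℝ (fun _ : Fin k => Space d) ℝ) (y : Space d) :
    ∃ p : MvPolynomial (Fin d) ℝ, p.totalDegree ≤ k ∧
      ∀ x, polyFun p x = A fun _ => x - y := by
  refine ⟨∑ κ : Fin k → Fin d, MvPolynomial.C (A fun j => EuclideanSpace.single (κ j) 1) *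
    ∏ j, (MvPolynomial.X (κ j) - MvPolynomial.C (y (κ j))), ?_, fun x => ?_⟩
  · refine MvPolynomial.totalDegree_finsetSum_le fun κ _ => ?_
    refine (MvPolynomial.totalDegree_mul _ _).trans ?_
    rw [MvPolynomial.totalDegree_C, zero_add]
    refine (MvPolynomial.totalDegree_finsetProd _ _).trans ?_
    refine (Finset.sum_le_card_nsmul _ _ 1 fun j _ => ?_).trans (by simp)
    refine (MvPolynomial.totalDegree_sub_C_le _ _).trans ?_
    exact (MvPolynomial.totalDegree_X _).le
  · have hx : x - y = ∑ i, (x i - y i) • (EuclideanSpace.single i (1 : ℝ) : Space d) := by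
      ext j
      simp [Pi.single_apply]
    have h1 := A.toMultilinearMap.map_sum
      (fun (_ : Fin k) (i : Fin d) => (x i - y i) • (EuclideanSpace.single i (1 : ℝ) : Space d))
    simp only [ContinuousMultilinearMap.coe_coe] at h1
    rw [hx, h1]
    simp only [polyFun, map_sum, map_mul, map_prod, map_sub, MvPolynomial.eval_C,
      MvPolynomial.eval_X]
    refine Finset.sum_congr rfl fun κ _ => ?_
    have h2 := A.map_smul_univ (fun j => x (κ j) - y (κ j))
      (fun j => (EuclideanSpace.single (κ j) (1 : ℝ) : Space d))
    rw [h2, smul_eq_mul, mul_comm]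

/-! ### Polynomial approximation of smooth functions on convex sets -/

/-- Cauchy-Schwarz against the constant 1. It serves both for the Taylor remainder (t in the unit
interval) and for convolution with a kernel of mass one. -/
theorem sq_lintegral_le {α : Type*} [MeasurableSpace α] (μ : Measure α) [IsProbabilityMeasure μ]
    {f : α → ℝ≥0∞} (hf : AEMeasurable f μ) : (∫⁻ a, f a ∂μ) ^ 2 ≤ ∫⁻ a, f a ^ 2 ∂μ := by
  have h := ENNReal.lintegral_mul_le_Lp_mul_Lq μ Real.HolderConjugate.two_two hf
    (aemeasurable_const (b := (1 : ℝ≥0∞)))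
  simp only [Pi.mul_apply, mul_one, ENNReal.one_rpow, lintegral_const, measure_univ] at h
  calc (∫⁻ a, f a ∂μ) ^ 2 ≤ ((∫⁻ a, f a ^ (2 : ℝ) ∂μ) ^ (1 / (2 : ℝ))) ^ 2 := by gcongr
    _ = ∫⁻ a, f a ^ 2 ∂μ := by
      rw [← ENNReal.rpow_natCast, ← ENNReal.rpow_mul]
      norm_num

theorem lintegral_comp_add_smul {d : ℕ} {t : ℝ} (ht : 0 < t) (a : Space d) {G : Space d → ℝ≥0∞}
    (hG : Measurable G) :
    ∫⁻ x, G (a + t • x) = ENNReal.ofReal (t ^ d)⁻¹ * ∫⁻ x, G x := by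
  have h1 := lintegral_map (μ := volume) (f := fun x => G (a + x)) (g := fun x : Space d => t • x)
    (hG.comp (measurable_const_add a)) (measurable_const_smul t)
  rw [← h1, Measure.map_addHaar_smul volume ht.ne', lintegral_smul_measure,
    lintegral_add_left_eq_self, finrank_euclideanSpace_fin, abs_of_pos (by positivity), smul_eq_mul]

/-- By convexity the homothety with centre y and ratio t maps D into itself; its Jacobian t^d is at
least 2^(-d). -/
theorem setLIntegral_segment_le {d : ℕ} {D : Set (Space d)} (hD : Convex ℝ D)
    (hm : MeasurableSet D) {G : Space d → ℝ≥0∞} (hG : Measurable G) {y : Space d} (hy : y ∈ D)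
    {t : ℝ} (ht : 1 / 2 ≤ t) (ht1 : t ≤ 1) :
    ∫⁻ x in D, G (y + t • (x - y)) ≤ 2 ^ d * ∫⁻ x in D, G x := by
  have ht0 : 0 < t := by linarith
  calc ∫⁻ x in D, G (y + t • (x - y))
      ≤ ∫⁻ x in D, D.indicator G ((y - t • y) + t • x) := by
        refine setLIntegral_mono' hm fun x hx => ?_
        have h1 : y + t • (x - y) = (y - t • y) + t • x := by
          rw [smul_sub]; abel
        have h2 : y + t • (x - y) ∈ D := hD.add_smul_sub_mem hy hx ⟨ht0.le, ht1⟩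
        rw [← h1, Set.indicator_of_mem h2]
    _ ≤ ∫⁻ x, D.indicator G ((y - t • y) + t • x) := setLIntegral_le_lintegral _ _
    _ = ENNReal.ofReal (t ^ d)⁻¹ * ∫⁻ x in D, G x := by
        rw [lintegral_comp_add_smul ht0 _ (hG.indicator hm), lintegral_indicator hm]
    _ ≤ 2 ^ d * ∫⁻ x in D, G x := by
        gcongr
        rw [ENNReal.ofReal_le_iff_le_toReal (by simp), ← inv_pow]
        simp only [ENNReal.toReal_pow, ENNReal.toReal_ofNat]
        gcongr
        rw [inv_le_comm₀ ht0 two_pos]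
        linarith

/-- The point y + t(x - y) = x + (1 - t)(y - x) is a homothetic image of x with ratio t and of y
with ratio 1 - t. One of the ratios is at least 1/2, so integrating first in the corresponding
variable avoids the degeneration at t = 0. -/
theorem setLIntegral_setLIntegral_segment_le {d : ℕ} {D : Set (Space d)} (hD : Convex ℝ D)
    (hm : MeasurableSet D) {G : Space d → ℝ≥0∞} (hG : Measurable G)
    {t : ℝ} (ht : t ∈ Set.Icc (0 : ℝ) 1) :
    ∫⁻ y in D, ∫⁻ x in D, G (y + t • (x - y)) ≤ volume D * (2 ^ d * ∫⁻ x in D, G x) := by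
  rcases le_total (1 / 2) t with h | h
  · calc ∫⁻ y in D, ∫⁻ x in D, G (y + t • (x - y))
        ≤ ∫⁻ _ in D, 2 ^ d * ∫⁻ x in D, G x :=
          setLIntegral_mono' hm fun y hy => setLIntegral_segment_le hD hm hG hy h ht.2
      _ = _ := by rw [setLIntegral_const, mul_comm]
  · rw [lintegral_lintegral_swap (Measurable.aemeasurable (by
      unfold Function.uncurry
      exact hG.comp (by fun_prop)))]
    calc ∫⁻ x in D, ∫⁻ y in D, G (y + t • (x - y))
        ≤ ∫⁻ _ in D, 2 ^ d * ∫⁻ x in D, G x := by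
          refine setLIntegral_mono' hm fun x hx => ?_
          have := setLIntegral_segment_le hD hm hG hx (t := 1 - t) (by linarith)
            (by linarith [ht.1])
          refine le_trans (le_of_eq ?_) this
          refine lintegral_congr fun y => ?_
          congr 1
          module
      _ = _ := by rw [setLIntegral_const, mul_comm]

/-- Integral form of the remainder: 1/m! and (1 - t)^m are discarded as at most 1, the direction x -
y contributes h^(m+1), and the square is moved under the integral by Jensen. -/
theorem enorm_sub_taylor_sq_le {d m : ℕ} {g : Space d → ℝ} (hg : ContDiff ℝ ∞ g)
    {x y : Space d} {h : ℝ} (hxy : ‖x - y‖ ≤ h) :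
    ‖g x - ∑ k ∈ Finset.range (m + 1), (k.factorial : ℝ)⁻¹ •
        iteratedFDeriv ℝ k g y (fun _ => x - y)‖ₑ ^ 2
      ≤ ENNReal.ofReal (h ^ (2 * (m + 1))) * ∫⁻ t in Set.Ioc (0 : ℝ) 1,
          ‖iteratedFDeriv ℝ (m + 1) g (y + t • (x - y))‖ₑ ^ 2 := by
  have hh : 0 ≤ h := (norm_nonneg _).trans hxy
  have hT := map_add_eq_sum_add_integral_iteratedFDeriv (f := g) (x := y) (y := x - y) (n := m)
    (fun t _ => (hg.of_le (by exact_mod_cast le_top)).contDiffAt)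
  rw [add_sub_cancel] at hT
  rw [hT, add_sub_cancel_left, intervalIntegral.integral_of_le zero_le_one]
  have hprob : IsProbabilityMeasure (volume.restrict (Set.Ioc (0 : ℝ) 1)) := ⟨by simp⟩
  have hcont : Continuous fun t : ℝ => iteratedFDeriv ℝ (m + 1) g (y + t • (x - y)) :=
    (hg.continuous_iteratedFDeriv (by exact_mod_cast le_top)).comp (by fun_prop)
  have h1 : ‖(m.factorial : ℝ)⁻¹ • ∫ t in Set.Ioc (0 : ℝ) 1,
      (1 - t) ^ m • iteratedFDeriv ℝ (m + 1) g (y + t • (x - y)) (fun _ => x - y)‖ₑ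
      ≤ ENNReal.ofReal (h ^ (m + 1)) * ∫⁻ t in Set.Ioc (0 : ℝ) 1,
          ‖iteratedFDeriv ℝ (m + 1) g (y + t • (x - y))‖ₑ := by
    rw [enorm_smul, ← lintegral_const_mul' _ _ ENNReal.ofReal_ne_top]
    have h2 : ‖(m.factorial : ℝ)⁻¹‖ₑ ≤ 1 := by
      rw [← ofReal_norm, ENNReal.ofReal_le_one, norm_inv, Real.norm_natCast]
      exact inv_le_one_of_one_le₀ (by exact_mod_cast Nat.one_le_iff_ne_zero.2 m.factorial_ne_zero)
    refine (mul_le_of_le_one_left' h2).trans ((enorm_integral_le_lintegral_enorm _).trans ?_)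
    refine setLIntegral_mono' measurableSet_Ioc fun t ht => ?_
    rw [← ofReal_norm, ← ofReal_norm, ← ENNReal.ofReal_mul (by positivity)]
    refine ENNReal.ofReal_le_ofReal ?_
    rw [norm_smul]
    have h3 : ‖(1 - t) ^ m‖ ≤ 1 := by
      rw [norm_pow]
      refine pow_le_one₀ (norm_nonneg _) ?_
      rw [Real.norm_eq_abs, abs_le]
      constructor <;> linarith [ht.1, ht.2]
    have h4 := (iteratedFDeriv ℝ (m + 1) g (y + t • (x - y))).le_opNorm (fun _ => x - y)
    rw [Finset.prod_const, Finset.card_univ, Fintype.card_fin] at h4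
    calc _ ≤ 1 * (‖iteratedFDeriv ℝ (m + 1) g (y + t • (x - y))‖ * ‖x - y‖ ^ (m + 1)) := by
          gcongr
      _ ≤ ‖iteratedFDeriv ℝ (m + 1) g (y + t • (x - y))‖ * h ^ (m + 1) := by
          rw [one_mul]; gcongr
      _ = _ := mul_comm _ _
  calc _ ≤ (ENNReal.ofReal (h ^ (m + 1)) * ∫⁻ t in Set.Ioc (0 : ℝ) 1,
          ‖iteratedFDeriv ℝ (m + 1) g (y + t • (x - y))‖ₑ) ^ 2 := by gcongr
    _ ≤ _ := by
        rw [mul_pow, ← ENNReal.ofReal_pow (by positivity), ← pow_mul, mul_comm (m + 1) 2]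
        gcongr
        exact sq_lintegral_le _ hcont.enorm.aemeasurable

theorem exists_polyFun_eq_taylor {d m : ℕ} (g : Space d → ℝ) (y : Space d) :
    ∃ p : MvPolynomial (Fin d) ℝ, p.totalDegree ≤ m ∧ ∀ x, polyFun p x =
      ∑ k ∈ Finset.range (m + 1), (k.factorial : ℝ)⁻¹ •
        iteratedFDeriv ℝ k g y (fun _ => x - y) := by
  choose P hP hPx using fun k => exists_polyFun_eq_multilinear (iteratedFDeriv ℝ k g y) y
  refine ⟨∑ k ∈ Finset.range (m + 1), (k.factorial : ℝ)⁻¹ • P k, ?_, fun x => ?_⟩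
  · refine MvPolynomial.totalDegree_finsetSum_le fun k hk => ?_
    exact (MvPolynomial.totalDegree_smul_le _ _).trans
      ((hP k).trans (Nat.lt_succ_iff.1 (Finset.mem_range.1 hk)))
  · simp only [← hPx, polyFun, map_sum, MvPolynomial.smul_eval, smul_eq_mul]

/-- Averaging over the base point replaces values of the top derivative along segments, which an L²
norm does not control for fixed y, by its integral over D. -/
theorem exists_polyFun_approx_smooth {d m : ℕ} {D : Set (Space d)} (hD : Convex ℝ D)
    (hm : MeasurableSet D) (hb : Bornology.IsBounded D) {h : ℝ} (hh : Metric.diam D ≤ h)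
    {g : Space d → ℝ} (hg : ContDiff ℝ ∞ g) :
    ∃ p : MvPolynomial (Fin d) ℝ, p.totalDegree ≤ m ∧
      ∫⁻ x in D, ‖g x - polyFun p x‖ₑ ^ 2 ≤ ENNReal.ofReal (h ^ (2 * (m + 1))) *
        (2 ^ d * ∫⁻ x in D, ‖iteratedFDeriv ℝ (m + 1) g x‖ₑ ^ 2) := by
  -- The average over D needs positive measure; on a null set any polynomial will do.
  rcases eq_or_ne (volume D) 0 with h0 | h0
  · exact ⟨0, by simp, by simp [Measure.restrict_eq_zero.2 h0]⟩
  have hcont : Continuous (iteratedFDeriv ℝ (m + 1) g) :=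
    hg.continuous_iteratedFDeriv (by exact_mod_cast le_top)
  let G : Space d → ℝ≥0∞ := fun z => ‖iteratedFDeriv ℝ (m + 1) g z‖ₑ ^ 2
  have hG : Measurable G := hcont.enorm.measurable.pow_const 2
  have hm1 : Measurable fun q : (Space d × Space d) × ℝ => G (q.1.1 + q.2 • (q.1.2 - q.1.1)) :=
    hG.comp (by fun_prop)
  have hm2 : Measurable fun q : Space d × Space d =>
      ∫⁻ t in Set.Ioc (0 : ℝ) 1, G (q.1 + t • (q.2 - q.1)) := hm1.lintegral_prod_right'
  have hm3 : Measurable fun y : Space d =>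
      ∫⁻ x in D, ∫⁻ t in Set.Ioc (0 : ℝ) 1, G (y + t • (x - y)) := hm2.lintegral_prod_right'
  have hfin : volume D ≠ ⊤ := hb.measure_lt_top.ne
  obtain ⟨y, hy, hyle⟩ := exists_le_setLAverage h0 hfin hm3.aemeasurable
  have key : ∫⁻ y in D, ∫⁻ x in D, ∫⁻ t in Set.Ioc (0 : ℝ) 1, G (y + t • (x - y))
      ≤ volume D * (2 ^ d * ∫⁻ x in D, G x) := by
    have e1 : ∫⁻ y in D, ∫⁻ x in D, ∫⁻ t in Set.Ioc (0 : ℝ) 1, G (y + t • (x - y))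
        = ∫⁻ t in Set.Ioc (0 : ℝ) 1, ∫⁻ y in D, ∫⁻ x in D, G (y + t • (x - y)) := by
      have e2 : ∀ y, ∫⁻ x in D, ∫⁻ t in Set.Ioc (0 : ℝ) 1, G (y + t • (x - y))
          = ∫⁻ t in Set.Ioc (0 : ℝ) 1, ∫⁻ x in D, G (y + t • (x - y)) := fun y =>
        lintegral_lintegral_swap (hm1.comp (by fun_prop :
          Measurable fun q : Space d × ℝ => ((y, q.1), q.2))).aemeasurable
      simp_rw [e2]
      refine lintegral_lintegral_swap (Measurable.aemeasurable ?_)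
      exact (hm1.comp (by fun_prop : Measurable fun q : (Space d × ℝ) × Space d =>
          ((q.1.1, q.2), q.1.2))).lintegral_prod_right'
    rw [e1]
    calc _ ≤ ∫⁻ _ in Set.Ioc (0 : ℝ) 1, volume D * (2 ^ d * ∫⁻ x in D, G x) :=
          setLIntegral_mono' measurableSet_Ioc fun t ht =>
            setLIntegral_setLIntegral_segment_le hD hm hG ⟨ht.1.le, ht.2⟩
      _ = _ := by simp
  have hy2 : ∫⁻ x in D, ∫⁻ t in Set.Ioc (0 : ℝ) 1, G (y + t • (x - y))
      ≤ 2 ^ d * ∫⁻ x in D, G x := by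
    refine hyle.trans ?_
    rw [setLAverage_eq]
    exact ENNReal.div_le_of_le_mul' key
  obtain ⟨p, hp, hpx⟩ := exists_polyFun_eq_taylor (m := m) g y
  refine ⟨p, hp, ?_⟩
  calc ∫⁻ x in D, ‖g x - polyFun p x‖ₑ ^ 2
      ≤ ∫⁻ x in D, ENNReal.ofReal (h ^ (2 * (m + 1))) *
          ∫⁻ t in Set.Ioc (0 : ℝ) 1, G (y + t • (x - y)) := by
        refine setLIntegral_mono' hm fun x hx => ?_
        rw [hpx]
        refine enorm_sub_taylor_sq_le hg ?_
        rw [← dist_eq_norm]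
        exact (Metric.dist_le_diam_of_mem hb hx hy).trans hh
    _ ≤ _ := by
        rw [lintegral_const_mul' _ _ ENNReal.ofReal_ne_top]
        gcongr

theorem eLpNorm_two_sq {α F : Type*} [MeasurableSpace α] [NormedAddCommGroup F] (μ : Measure α)
    (f : α → F) : eLpNorm f 2 μ ^ 2 = ∫⁻ a, ‖f a‖ₑ ^ 2 ∂μ := by
  have := eLpNorm_nnreal_pow_eq_lintegral (μ := μ) (f := f) (p := 2) two_ne_zero
  simpa using this

theorem eLpNorm_two_le_iff {α F : Type*} [MeasurableSpace α] [NormedAddCommGroup F]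
    {μ : Measure α} {f : α → F} {K : ℝ≥0∞} :
    eLpNorm f 2 μ ≤ K ↔ ∫⁻ a, ‖f a‖ₑ ^ 2 ∂μ ≤ K ^ 2 := by
  rw [← eLpNorm_two_sq, ENNReal.pow_le_pow_left_iff two_ne_zero]

theorem exists_polyFun_approx_smooth_eLpNorm {d m : ℕ} {D : Set (Space d)} (hD : Convex ℝ D)
    (hm : MeasurableSet D) (hb : Bornology.IsBounded D) {h : ℝ} (hh : Metric.diam D ≤ h)
    {g : Space d → ℝ} (hg : ContDiff ℝ ∞ g) {K : ℝ≥0∞}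
    (hK : eLpNorm (iteratedFDeriv ℝ (m + 1) g) 2 (volume.restrict D) ≤ K) :
    ∃ p : MvPolynomial (Fin d) ℝ, p.totalDegree ≤ m ∧
      eLpNorm (fun x => g x - polyFun p x) 2 (volume.restrict D)
        ≤ ENNReal.ofReal (h ^ (m + 1)) * (2 ^ d * K) := by
  obtain ⟨p, hp, hpx⟩ := exists_polyFun_approx_smooth (m := m) hD hm hb hh hg
  refine ⟨p, hp, eLpNorm_two_le_iff.2 (hpx.trans ?_)⟩
  have hh0 : 0 ≤ h := Metric.diam_nonneg.trans hh
  rw [← eLpNorm_two_sq, mul_pow, mul_pow, ← ENNReal.ofReal_pow (by positivity), ← pow_mul,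
    mul_comm (m + 1) 2]
  -- The exact root would be 2^(d/2); the larger 2^d avoids a fractional exponent.
  have h2 : (1 : ℝ≥0∞) ≤ 2 ^ d := one_le_pow₀ one_le_two
  exact mul_le_mul' le_rfl (mul_le_mul' (le_self_pow₀ h2 two_ne_zero) (by gcongr))

/-- The smooth estimate is available only on `E n`. The fixed open set B inside every `E n` gives a
common norm in which the polynomials are bounded, so that compactness yields a limit polynomial. -/
theorem exists_polyFun_approx_of_tendsto {d m : ℕ} {D : Set (Space d)}
    (hb : Bornology.IsBounded D) {h : ℝ} (hh : Metric.diam D ≤ h)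
    {E : ℕ → Set (Space d)} (hEc : ∀ n, Convex ℝ (E n)) (hEm : ∀ n, MeasurableSet (E n))
    (hED : ∀ n, E n ⊆ D) (hE : ∀ x ∈ D, ∀ᶠ n in atTop, x ∈ E n) (hDm : MeasurableSet D)
    {B : Set (Space d)} (hBo : IsOpen B) (hBne : B.Nonempty) (hBE : ∀ n, B ⊆ E n)
    {g : Space d → ℝ} {gs : ℕ → Space d → ℝ} (hgs : ∀ n, ContDiff ℝ ∞ (gs n))
    (hlim : ∀ᵐ x ∂(volume.restrict D), Tendsto (fun n => gs n x) atTop (𝓝 (g x)))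
    {K K' : ℝ≥0∞} (hKt : K ≠ ⊤) (hK't : K' ≠ ⊤)
    (hK : ∀ n, eLpNorm (iteratedFDeriv ℝ (m + 1) (gs n)) 2 (volume.restrict (E n)) ≤ K)
    (hK' : ∀ n, eLpNorm (gs n) 2 (volume.restrict (E n)) ≤ K') :
    ∃ p : MvPolynomial (Fin d) ℝ, p.totalDegree ≤ m ∧
      eLpNorm (fun x => g x - polyFun p x) 2 (volume.restrict D)
        ≤ ENNReal.ofReal (h ^ (m + 1)) * (2 ^ d * K) := by
  set C := ENNReal.ofReal (h ^ (m + 1)) * (2 ^ d * K)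
  have hC : C ≠ ⊤ := ENNReal.mul_ne_top ENNReal.ofReal_ne_top
    (ENNReal.mul_ne_top (by simp) hKt)
  choose p hp hpx using fun n => exists_polyFun_approx_smooth_eLpNorm (m := m) (hEc n) (hEm n)
    (hb.subset (hED n)) ((Metric.diam_mono (hED n) hb).trans hh) (hgs n) (hK n)
  have hpB : ∀ n, eLpNorm (polyFun (p n)) 2 (volume.restrict B) ≤ K' + C := by
    intro n
    have hg1 : AEStronglyMeasurable (gs n) (volume.restrict (E n)) :=
      (hgs n).continuous.aestronglyMeasurable
    have hp1 : AEStronglyMeasurable (polyFun (p n)) (volume.restrict (E n)) :=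
      (continuous_polyFun _).aestronglyMeasurable
    have e : polyFun (p n) = gs n - fun x => gs n x - polyFun (p n) x := by
      funext x; simp
    calc eLpNorm (polyFun (p n)) 2 (volume.restrict B)
        ≤ eLpNorm (polyFun (p n)) 2 (volume.restrict (E n)) :=
          eLpNorm_mono_measure _ (Measure.restrict_mono (hBE n) le_rfl)
      _ ≤ eLpNorm (gs n) 2 (volume.restrict (E n)) +
          eLpNorm (fun x => gs n x - polyFun (p n) x) 2 (volume.restrict (E n)) := by
          conv_lhs => rw [e]
          exact eLpNorm_sub_le hg1 (hg1.sub hp1) (by norm_num)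
      _ ≤ K' + C := add_le_add (hK' n) (hpx n)
  obtain ⟨q, hq, φ, hφ, hφlim⟩ := exists_subseq_tendsto_polyFun hBo hBne
    (hb.subset ((hBE 0).trans (hED 0))) hp (ENNReal.add_ne_top.2 ⟨hK't, hC⟩) hpB
  refine ⟨q, hq, eLpNorm_two_le_iff.2 ?_⟩
  -- Extending the squared errors by zero off `E (φ n)` puts them all on D for Fatou's lemma; at
  -- each point of D the indicator is eventually 1.
  let F : ℕ → Space d → ℝ≥0∞ := fun n =>
    (E (φ n)).indicator fun x => ‖gs (φ n) x - polyFun (p (φ n)) x‖ₑ ^ 2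
  have hFm : ∀ n, Measurable (F n) := fun n =>
    ((((hgs (φ n)).continuous.sub (continuous_polyFun (p (φ n)))).enorm.measurable).pow_const
      2).indicator (hEm _)
  have hFle : ∀ n, ∫⁻ x in D, F n x ≤ C ^ 2 := by
    intro n
    rw [lintegral_indicator (hEm _), Measure.restrict_restrict (hEm _),
      Set.inter_eq_left.2 (hED _)]
    exact eLpNorm_two_le_iff.1 (hpx (φ n))
  calc ∫⁻ x in D, ‖g x - polyFun q x‖ₑ ^ 2
      ≤ ∫⁻ x in D, liminf (fun n => F n x) atTop := by
        refine lintegral_mono_ae ?_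
        filter_upwards [hlim, ae_restrict_mem hDm] with x hx hxD
        refine le_of_eq (Tendsto.liminf_eq ?_).symm
        have h1 : Tendsto (fun n => ‖gs (φ n) x - polyFun (p (φ n)) x‖ₑ ^ 2) atTop
            (𝓝 (‖g x - polyFun q x‖ₑ ^ 2)) :=
          ENNReal.Tendsto.pow ((hx.comp hφ.tendsto_atTop).sub (hφlim x)).enorm
        refine h1.congr' ?_
        filter_upwards [hφ.tendsto_atTop.eventually (hE x hxD)] with n hn
        simp only [F, Set.indicator_of_mem hn]
    _ ≤ liminf (fun n => ∫⁻ x in D, F n x) atTop := lintegral_liminf_le hFm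
    _ ≤ C ^ 2 := by
        refine liminf_le_of_frequently_le' (Frequently.of_forall hFle)

/-! ### Mollification -/

/-- The mollification by the bump function `φ` of the extension of `u` from `D` by zero. -/
def mollify {d : ℕ} (φ : ContDiffBump (0 : Space d)) (D : Set (Space d)) (u : Space d → ℝ) :
    Space d → ℝ :=
  convolution (φ.normed volume) (D.indicator u) (ContinuousLinearMap.lsmul ℝ ℝ) volume

theorem convolution_indicator_apply {d : ℕ} (f : Space d → ℝ) {D : Set (Space d)}
    (hD : MeasurableSet D) (u : Space d → ℝ) (x : Space d) :
    convolution f (D.indicator u) (ContinuousLinearMap.lsmul ℝ ℝ) volume x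
      = ∫ t in D, u t * f (x - t) := by
  rw [convolution_eq_swap, ← integral_indicator hD]
  refine integral_congr_ae (Eventually.of_forall fun t => ?_)
  by_cases ht : t ∈ D <;> simp [ht, mul_comm]

theorem lintegral_enorm_normed_sub {d : ℕ} (φ : ContDiffBump (0 : Space d)) (x : Space d) :
    ∫⁻ t, ‖φ.normed volume (x - t)‖ₑ = 1 := by
  rw [lintegral_sub_left_eq_self (fun t => ‖φ.normed volume t‖ₑ) x]
  have h1 : ∀ t, ‖φ.normed volume t‖ₑ = ENNReal.ofReal (φ.normed volume t) := fun t =>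
    Real.enorm_of_nonneg (φ.nonneg_normed t)
  simp_rw [h1]
  rw [← ofReal_integral_eq_lintegral_ofReal φ.integrable_normed
    (Eventually.of_forall φ.nonneg_normed), φ.integral_normed, ENNReal.ofReal_one]

theorem enorm_mollify_le_eLpNorm_top {d : ℕ} (φ : ContDiffBump (0 : Space d)) {D : Set (Space d)}
    (hD : MeasurableSet D) (u : Space d → ℝ) (x : Space d) :
    ‖mollify φ D u x‖ₑ ≤ eLpNorm u ⊤ (volume.restrict D) := by
  rw [mollify, convolution_indicator_apply _ hD]
  calc _ ≤ ∫⁻ t in D, ‖u t * φ.normed volume (x - t)‖ₑ := enorm_integral_le_lintegral_enorm _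
    _ ≤ ∫⁻ t in D, eLpNorm u ⊤ (volume.restrict D) * ‖φ.normed volume (x - t)‖ₑ := by
        refine lintegral_mono_ae ?_
        filter_upwards [enorm_ae_le_eLpNormEssSup u (volume.restrict D)] with t ht
        rw [enorm_mul, eLpNorm_exponent_top]
        gcongr
    _ ≤ ∫⁻ t, eLpNorm u ⊤ (volume.restrict D) * ‖φ.normed volume (x - t)‖ₑ :=
        setLIntegral_le_lintegral _ _
    _ = _ := by
        have hm : Measurable fun t : Space d => ‖φ.normed volume (x - t)‖ₑ :=
          φ.continuous_normed.enorm.measurable.comp (measurable_const_sub x)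
        rw [lintegral_const_mul _ hm, lintegral_enorm_normed_sub, mul_one]

/-- Young's inequality: for fixed x the kernel is a probability density, so Jensen gives a pointwise
bound, and Tonelli then integrates the kernel to 1 in the other variable. -/
theorem eLpNorm_two_mollify_le {d : ℕ} (φ : ContDiffBump (0 : Space d)) {D : Set (Space d)}
    (hD : MeasurableSet D) {u : Space d → ℝ} (hu : AEStronglyMeasurable u (volume.restrict D)) :
    eLpNorm (mollify φ D u) 2 volume ≤ eLpNorm u 2 (volume.restrict D) := by
  rw [eLpNorm_two_le_iff, eLpNorm_two_sq, ← lintegral_indicator hD]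
  let F : Space d → ℝ≥0∞ := D.indicator fun t => ‖u t‖ₑ
  have hF : AEMeasurable F volume := (aemeasurable_indicator_iff hD).2 hu.enorm
  have hφm : Measurable fun t : Space d => ‖φ.normed volume t‖ₑ :=
    φ.continuous_normed.enorm.measurable
  have hpt : ∀ x, ‖mollify φ D u x‖ₑ ^ 2 ≤ ∫⁻ t, ‖φ.normed volume (x - t)‖ₑ * F t ^ 2 := by
    intro x
    have hφx : Measurable fun t : Space d => ‖φ.normed volume (x - t)‖ₑ :=
      hφm.comp (by fun_prop)
    let ν := volume.withDensity fun t => ‖φ.normed volume (x - t)‖ₑ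
    have hν : IsProbabilityMeasure ν :=
      ⟨by rw [withDensity_apply _ MeasurableSet.univ, Measure.restrict_univ,
        lintegral_enorm_normed_sub]⟩
    have h1 : ‖mollify φ D u x‖ₑ ≤ ∫⁻ t, F t ∂ν := by
      rw [mollify, convolution_indicator_apply _ hD,
        lintegral_withDensity_eq_lintegral_mul₀ hφx.aemeasurable hF]
      refine (enorm_integral_le_lintegral_enorm _).trans ?_
      rw [← lintegral_indicator hD]
      refine lintegral_mono fun t => ?_
      by_cases ht : t ∈ D <;> simp [ht, F, mul_comm]
    calc _ ≤ (∫⁻ t, F t ∂ν) ^ 2 := by gcongr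
      _ ≤ ∫⁻ t, F t ^ 2 ∂ν :=
          sq_lintegral_le ν (hF.mono_ac (withDensity_absolutelyContinuous _ _))
      _ = _ := by
          rw [lintegral_withDensity_eq_lintegral_mul₀ hφx.aemeasurable (hF.pow_const 2)]
          rfl
  calc ∫⁻ x, ‖mollify φ D u x‖ₑ ^ 2
      ≤ ∫⁻ x, ∫⁻ t, ‖φ.normed volume (x - t)‖ₑ * F t ^ 2 := lintegral_mono hpt
    _ = ∫⁻ t, ∫⁻ x, ‖φ.normed volume (x - t)‖ₑ * F t ^ 2 := by
        refine lintegral_lintegral_swap (AEMeasurable.mul ?_ ?_)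
        · exact (hφm.comp (by fun_prop :
            Measurable fun q : Space d × Space d => q.1 - q.2)).aemeasurable
        · exact (hF.pow_const 2).comp_snd
    _ = ∫⁻ t, F t ^ 2 := by
        refine lintegral_congr fun t => ?_
        have hm : Measurable fun x : Space d => ‖φ.normed volume (x - t)‖ₑ :=
          hφm.comp (measurable_sub_const t)
        rw [lintegral_mul_const _ hm,
          lintegral_sub_right_eq_self (fun x => ‖φ.normed volume x‖ₑ) t]
        have := lintegral_enorm_normed_sub φ 0
        simp only [zero_sub, φ.normed_neg] at this
        rw [this, one_mul]
    _ = ∫⁻ t, D.indicator (fun t => ‖u t‖ₑ ^ 2) t := by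
        refine lintegral_congr fun t => ?_
        by_cases ht : t ∈ D <;> simp [ht, F]

theorem contDiff_mollify {d : ℕ} (φ : ContDiffBump (0 : Space d)) {D : Set (Space d)}
    (hD : MeasurableSet D) {u : Space d → ℝ} (hu : IntegrableOn u D) :
    ContDiff ℝ ∞ (mollify φ D u) :=
  φ.hasCompactSupport_normed.contDiff_convolution_left _ φ.contDiff_normed
    ((integrable_indicator_iff hD).2 hu).locallyIntegrable

/-! ### Iterated partial derivatives -/

/-- The iterated partial derivative in the directions listed in `l`. -/
def listDeriv {d : ℕ} (l : List (Fin d)) (f : Space d → ℝ) : Space d → ℝ :=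
  l.foldr partialDeriv f

theorem listDeriv_cons {d : ℕ} (i : Fin d) (l : List (Fin d)) (f : Space d → ℝ) :
    listDeriv (i :: l) f = partialDeriv i (listDeriv l f) := rfl

/-- The list of directions of the derivative with multi-index `α`. -/
def multiList {d : ℕ} (α : Fin d → ℕ) : List (Fin d) :=
  (List.finRange d).flatMap fun i => List.replicate (α i) i

theorem multiDeriv_eq_listDeriv {d : ℕ} (α : Fin d → ℕ) (f : Space d → ℝ) :
    multiDeriv α f = listDeriv (multiList α) f := by
  unfold multiDeriv multiList listDeriv
  induction List.finRange d with
  | nil => rfl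
  | cons i l ih =>
    rw [List.foldr_cons, List.flatMap_cons, List.foldr_append, ih]
    generalize List.foldr partialDeriv f (List.flatMap (fun i => List.replicate (α i) i) l) = g
    induction α i with
    | zero => rfl
    | succ k hk => rw [Function.iterate_succ_apply', hk, List.replicate_succ, List.foldr_cons]

theorem length_multiList {d : ℕ} (α : Fin d → ℕ) : (multiList α).length = ∑ i, α i := by
  simp [multiList, List.length_flatMap, Fin.sum_univ_def]

theorem count_multiList {d : ℕ} (α : Fin d → ℕ) (i : Fin d) : (multiList α).count i = α i := by
  rw [multiList, List.count_flatMap]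
  have h1 : (List.count i ∘ fun j => List.replicate (α j) j) = fun j => if j = i then α j else 0 := by
    funext j
    simp [List.count_replicate]
  rw [h1, ← Fin.sum_univ_def]
  simp

theorem contDiff_partialDeriv {d : ℕ} (i : Fin d) {f : Space d → ℝ} (hf : ContDiff ℝ ∞ f) :
    ContDiff ℝ ∞ (partialDeriv i f) :=
  (hf.fderiv_right (m := ∞) (by simp)).clm_apply contDiff_const

theorem contDiff_listDeriv {d : ℕ} (l : List (Fin d)) {f : Space d → ℝ} (hf : ContDiff ℝ ∞ f) :
    ContDiff ℝ ∞ (listDeriv l f) := by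
  induction l with
  | nil => exact hf
  | cons i l ih => exact contDiff_partialDeriv i ih

theorem hasCompactSupport_partialDeriv {d : ℕ} (i : Fin d) {f : Space d → ℝ}
    (hf : HasCompactSupport f) : HasCompactSupport (partialDeriv i f) :=
  hf.fderiv_apply ℝ _

theorem hasCompactSupport_listDeriv {d : ℕ} (l : List (Fin d)) {f : Space d → ℝ}
    (hf : HasCompactSupport f) : HasCompactSupport (listDeriv l f) := by
  induction l with
  | nil => exact hf
  | cons i l ih => exact hasCompactSupport_partialDeriv i ih

theorem partialDeriv_comm {d : ℕ} (i j : Fin d) {f : Space d → ℝ} (hf : ContDiff ℝ ∞ f) :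
    partialDeriv i (partialDeriv j f) = partialDeriv j (partialDeriv i f) := by
  funext x
  have hd : DifferentiableAt ℝ (fderiv ℝ f) x :=
    ((hf.fderiv_right (m := ∞) (by simp)).differentiable (by simp)) x
  have h1 : ∀ a b : Fin d, partialDeriv a (partialDeriv b f) x =
      fderiv ℝ (fderiv ℝ f) x (EuclideanSpace.single a 1) (EuclideanSpace.single b 1) := by
    intro a b
    unfold partialDeriv
    rw [fderiv_clm_apply hd (differentiableAt_const _)]
    simp
  rw [h1, h1]
  exact (hf.contDiffAt.isSymmSndFDerivAt (by
    rw [minSmoothness_of_isRCLikeNormedField]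
    exact WithTop.coe_le_coe.2 le_top)).eq _ _

/-- A permutation is generated by adjacent transpositions, and each of these is the symmetry of the
second derivative. -/
theorem listDeriv_perm {d : ℕ} {l l' : List (Fin d)} (h : l.Perm l') {f : Space d → ℝ}
    (hf : ContDiff ℝ ∞ f) : listDeriv l f = listDeriv l' f := by
  induction h with
  | nil => rfl
  | cons i _ ih => rw [listDeriv_cons, listDeriv_cons, ih]
  | swap i j l =>
    simp only [listDeriv_cons]
    exact partialDeriv_comm _ _ (contDiff_listDeriv l hf)
  | trans _ _ ih1 ih2 => exact ih1.trans ih2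

theorem iteratedFDeriv_single {d k : ℕ} {f : Space d → ℝ} (hf : ContDiff ℝ ∞ f)
    (κ : Fin k → Fin d) (x : Space d) :
    iteratedFDeriv ℝ k f x (fun j => EuclideanSpace.single (κ j) 1)
      = listDeriv (List.ofFn κ) f x := by
  induction k generalizing x with
  | zero => simp [listDeriv]
  | succ k ih =>
    have hd : DifferentiableAt ℝ (iteratedFDeriv ℝ k f) x :=
      (hf.differentiable_iteratedFDeriv (by exact_mod_cast WithTop.coe_lt_top k)) x
    rw [List.ofFn_succ, listDeriv_cons, hd.iteratedFDeriv_succ_apply_left', partialDeriv]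
    congr 2
    funext z
    exact ih (fun j => κ j.succ) z

/-- The multi-index that counts the values of `κ`. -/
def countIndex {d k : ℕ} (κ : Fin k → Fin d) : Fin d → ℕ := fun i => (List.ofFn κ).count i

theorem sum_countIndex {d k : ℕ} (κ : Fin k → Fin d) : ∑ i, countIndex κ i = k := by
  have h : ∀ l : List (Fin d), ∑ i, l.count i = l.length := by
    intro l
    induction l with
    | nil => simp
    | cons a l ih => simp [List.count_cons, Finset.sum_add_distrib, ih]
  simpa [countIndex] using h (List.ofFn κ)

theorem iteratedFDeriv_single_eq_multiDeriv {d k : ℕ} {f : Space d → ℝ} (hf : ContDiff ℝ ∞ f)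
    (κ : Fin k → Fin d) (x : Space d) :
    iteratedFDeriv ℝ k f x (fun j => EuclideanSpace.single (κ j) 1)
      = multiDeriv (countIndex κ) f x := by
  rw [iteratedFDeriv_single hf, multiDeriv_eq_listDeriv]
  refine congrFun (listDeriv_perm ?_ hf) x
  rw [List.perm_iff_count]
  exact fun i => (count_multiList (countIndex κ) i).symm

/-- Expanding each argument in the standard basis leaves coordinates bounded by the norm. The sum
runs over index tuples, so mixed derivatives repeat; this is the source of the factors d^k below. -/
theorem norm_iteratedFDeriv_le_sum {d k : ℕ} {f : Space d → ℝ} (hf : ContDiff ℝ ∞ f)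
    (x : Space d) :
    ‖iteratedFDeriv ℝ k f x‖ ≤ ∑ κ : Fin k → Fin d, ‖multiDeriv (countIndex κ) f x‖ := by
  refine ContinuousMultilinearMap.opNorm_le_bound
    (Finset.sum_nonneg fun _ _ => norm_nonneg _) fun v => ?_
  have hv : v = fun j => ∑ i, v j i • (EuclideanSpace.single i (1 : ℝ) : Space d) := by
    funext j
    ext i
    simp [Pi.single_apply]
  have h1 := (iteratedFDeriv ℝ k f x).toMultilinearMap.map_sum
      (fun (j : Fin k) (i : Fin d) => v j i • (EuclideanSpace.single i (1 : ℝ) : Space d))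
  simp only [ContinuousMultilinearMap.coe_coe] at h1
  rw [← hv] at h1
  rw [h1, Finset.sum_mul]
  refine (norm_sum_le _ _).trans (Finset.sum_le_sum fun κ _ => ?_)
  have h2 := (iteratedFDeriv ℝ k f x).map_smul_univ (fun j => v j (κ j))
    (fun j => (EuclideanSpace.single (κ j) (1 : ℝ) : Space d))
  rw [h2, iteratedFDeriv_single_eq_multiDeriv hf, norm_smul, mul_comm, norm_prod]
  gcongr with j _
  exact PiLp.norm_apply_le (v j) (κ j)

theorem partialDeriv_convolution {d : ℕ} (i : Fin d) {f g : Space d → ℝ}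
    (hf : ContDiff ℝ ∞ f) (hc : HasCompactSupport f) (hg : LocallyIntegrable g) :
    partialDeriv i (convolution f g (ContinuousLinearMap.lsmul ℝ ℝ) volume)
      = convolution (partialDeriv i f) g (ContinuousLinearMap.lsmul ℝ ℝ) volume := by
  funext x
  have hf1 : ContDiff ℝ 1 f := hf.of_le (by exact_mod_cast le_top)
  unfold partialDeriv
  rw [(hc.hasFDerivAt_convolution_left (ContinuousLinearMap.lsmul ℝ ℝ) hf1 hg x).fderiv]
  unfold convolution
  rw [ContinuousLinearMap.integral_apply]
  · rfl
  · exact (hc.fderiv ℝ).convolutionExists_left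
      ((ContinuousLinearMap.lsmul ℝ ℝ : ℝ →L[ℝ] ℝ →L[ℝ] ℝ).precompL (Space d))
      (hf1.continuous_fderiv one_ne_zero) hg x

theorem listDeriv_convolution {d : ℕ} (l : List (Fin d)) {f g : Space d → ℝ}
    (hf : ContDiff ℝ ∞ f) (hc : HasCompactSupport f) (hg : LocallyIntegrable g) :
    listDeriv l (convolution f g (ContinuousLinearMap.lsmul ℝ ℝ) volume)
      = convolution (listDeriv l f) g (ContinuousLinearMap.lsmul ℝ ℝ) volume := by
  induction l with
  | nil => rfl
  | cons i l ih =>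
    rw [listDeriv_cons, ih, partialDeriv_convolution i (contDiff_listDeriv l hf)
      (hasCompactSupport_listDeriv l hc) hg, listDeriv_cons]

theorem listDeriv_comp_const_sub {d : ℕ} (l : List (Fin d)) {f : Space d → ℝ}
    (hf : ContDiff ℝ ∞ f) (x y : Space d) :
    listDeriv l (fun z => f (x - z)) y = (-1) ^ l.length * listDeriv l f (x - y) := by
  induction l generalizing y with
  | nil => simp [listDeriv]
  | cons i l ih =>
    have h1 : listDeriv l (fun z => f (x - z))
        = fun y => (-1) ^ l.length * listDeriv l f (x - y) := funext ih
    rw [listDeriv_cons, h1, listDeriv_cons, partialDeriv, partialDeriv, List.length_cons]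
    have hd : DifferentiableAt ℝ (listDeriv l f) (x - y) :=
      ((contDiff_listDeriv l hf).differentiable (by simp)) _
    have h2 : HasFDerivAt (fun y : Space d => x - y) (-ContinuousLinearMap.id ℝ (Space d)) y :=
      (hasFDerivAt_id y).const_sub x
    have h3 := (hd.hasFDerivAt.comp y h2).const_mul ((-1 : ℝ) ^ l.length)
    have h4 := h3.fderiv
    simp only [Function.comp_def] at h4
    rw [h4]
    simp [pow_succ]

/-- All derivatives fall on the kernel, and t ↦ φ(x - t) is an admissible test function because its
support lies in the closed ball around x. The sign from the reflection cancels the sign in the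
definition of the weak derivative. -/
theorem multiDeriv_mollify {d : ℕ} (φ : ContDiffBump (0 : Space d)) {D : Set (Space d)}
    (hD : MeasurableSet D) {u v : Space d → ℝ} (hu : IntegrableOn u D) {α : Fin d → ℕ}
    (huv : HasWeakDeriv D α u v) {x : Space d} (hx : Metric.closedBall x φ.rOut ⊆ D) :
    multiDeriv α (mollify φ D u) x = mollify φ D v x := by
  have hc : HasCompactSupport (φ.normed volume) := φ.hasCompactSupport_normed
  have hs : ContDiff ℝ ∞ (φ.normed volume) := φ.contDiff_normed
  have hli : LocallyIntegrable (D.indicator u) :=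
    ((integrable_indicator_iff hD).2 hu).locallyIntegrable
  have hsub : tsupport (fun t => φ.normed volume (x - t)) ⊆ Metric.closedBall x φ.rOut := by
    refine closure_minimal (fun t ht => ?_) Metric.isClosed_closedBall
    have h1 : x - t ∈ Function.support (φ.normed volume) := ht
    rw [φ.support_normed_eq, mem_ball_zero_iff] at h1
    rw [Metric.mem_closedBall, dist_comm, dist_eq_norm]
    exact h1.le
  have hwd := huv.2.2 (fun t => φ.normed volume (x - t)) (hs.comp (contDiff_const.sub contDiff_id))
    (HasCompactSupport.of_support_subset_isCompact (isCompact_closedBall x φ.rOut)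
      (subset_closure.trans hsub)) (hsub.trans hx)
  unfold mollify
  rw [convolution_indicator_apply _ hD, multiDeriv_eq_listDeriv,
    listDeriv_convolution _ hs hc hli, convolution_indicator_apply _ hD]
  simp_rw [multiDeriv_eq_listDeriv, listDeriv_comp_const_sub _ hs, length_multiList] at hwd
  have h1 : ∀ t, u t * ((-1) ^ (∑ i, α i) * listDeriv (multiList α) (φ.normed volume) (x - t))
      = (-1) ^ (∑ i, α i) * (u t * listDeriv (multiList α) (φ.normed volume) (x - t)) := by
    intro t; ring
  simp_rw [h1] at hwd
  rw [integral_const_mul] at hwd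
  exact mul_left_cancel₀ (pow_ne_zero _ (by norm_num)) hwd

/-! ### Weak derivatives and Sobolev norms -/

/-- The fundamental lemma of the calculus of variations; it makes the representative chosen in
`weakDeriv` immaterial for norms. -/
theorem HasWeakDeriv.ae_eq {d : ℕ} {D : Set (Space d)} (hD : IsOpen D) {α : Fin d → ℕ}
    {u g g' : Space d → ℝ} (hg : HasWeakDeriv D α u g) (hg' : HasWeakDeriv D α u g') :
    g =ᵐ[volume.restrict D] g' := by
  have h := hD.ae_eq_zero_of_integral_contDiff_smul_eq_zero (μ := volume) (hg.2.1.sub hg'.2.1)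
    fun φ hφ hc hs => by
      have hint : ∀ {f : Space d → ℝ}, LocallyIntegrableOn f D →
          Integrable (fun x => f x * φ x) := by
        intro f hf
        have hK : IntegrableOn f (tsupport φ) := hf.integrableOn_compact_subset hs hc
        have h1 : IntegrableOn (fun x => f x * φ x) (tsupport φ) :=
          hK.mul_continuousOn hφ.continuous.continuousOn hc
        refine (integrableOn_iff_integrable_of_support_subset fun x hx => ?_).1 h1
        exact subset_tsupport φ (right_ne_zero_of_mul hx)
      have hset : ∀ f : Space d → ℝ, ∫ x in D, f x * φ x = ∫ x, f x * φ x := by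
        intro f
        refine setIntegral_eq_integral_of_forall_compl_eq_zero fun x hx => ?_
        rw [image_eq_zero_of_notMem_tsupport fun hx' => hx (hs hx'), mul_zero]
      have e1 := hg.2.2 φ hφ hc hs
      rw [hg'.2.2 φ hφ hc hs] at e1
      have e2 := mul_left_cancel₀ (pow_ne_zero _ (by norm_num)) e1
      rw [hset, hset] at e2
      calc ∫ x, φ x • (g - g') x = ∫ x, (g x * φ x - g' x * φ x) := by
            refine integral_congr_ae (Eventually.of_forall fun x => ?_)
            simp only [Pi.sub_apply, smul_eq_mul]
            ring
        _ = 0 := by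
            rw [integral_sub (hint hg.2.1) (hint hg'.2.1), e2, sub_self]
  rw [EventuallyEq, ae_restrict_iff' hD.measurableSet]
  filter_upwards [h] with x hx hxD
  exact sub_eq_zero.1 (hx hxD)

theorem hasWeakDeriv_zero {d : ℕ} {D : Set (Space d)} {u : Space d → ℝ}
    (hu : LocallyIntegrableOn u D) : HasWeakDeriv D 0 u u := by
  refine ⟨hu, hu, fun φ _ _ _ => ?_⟩
  have h1 : multiDeriv 0 φ = φ := by
    rw [multiDeriv_eq_listDeriv,
      List.eq_nil_of_length_eq_zero (l := multiList (0 : Fin d → ℕ)) (by simp [length_multiList])]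
    rfl
  simp [h1]

theorem MemSobolev.hasWeakDeriv {d s : ℕ} {D : Set (Space d)} {p : ℝ≥0∞} {u : Space d → ℝ}
    (hu : MemSobolev D s p u) {α : Fin d → ℕ} (hα : α ∈ multiIndices d s) :
    HasWeakDeriv D α u (weakDeriv D α u) := by
  have h : ∃ g, HasWeakDeriv D α u g := (hu.2 α hα).imp fun _ h => h.1
  rw [weakDeriv, dif_pos h]
  exact h.choose_spec

theorem MemSobolev.memLp_weakDeriv {d s : ℕ} {D : Set (Space d)} (hD : IsOpen D) {p : ℝ≥0∞}
    {u : Space d → ℝ} (hu : MemSobolev D s p u) {α : Fin d → ℕ} (hα : α ∈ multiIndices d s) :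
    MemLp (weakDeriv D α u) p (volume.restrict D) := by
  obtain ⟨g, hg, hgp⟩ := hu.2 α hα
  exact (memLp_congr_ae (hg.ae_eq hD (hu.hasWeakDeriv hα))).1 hgp

theorem countIndex_mem_multiIndices {d k s : ℕ} (hk : k ≤ s) (κ : Fin k → Fin d) :
    countIndex κ ∈ multiIndices d s := by
  have hsum := sum_countIndex κ
  refine Finset.mem_filter.2 ⟨Fintype.mem_piFinset.2 fun i => ?_, hsum.le.trans hk⟩
  have : countIndex κ i ≤ ∑ i, countIndex κ i :=
    Finset.single_le_sum (fun _ _ => Nat.zero_le _) (Finset.mem_univ i)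
  exact Finset.mem_range.2 (by omega)

theorem zero_mem_multiIndices (d s : ℕ) : (0 : Fin d → ℕ) ∈ multiIndices d s := by
  simp [multiIndices]

theorem eLpNorm_weakDeriv_le_sobolevENorm_top {d s : ℕ} (D : Set (Space d)) {α : Fin d → ℕ}
    (hα : α ∈ multiIndices d s) (u : Space d → ℝ) :
    eLpNorm (weakDeriv D α u) ⊤ (volume.restrict D) ≤ sobolevENorm D s ⊤ u := by
  rw [sobolevENorm, if_pos rfl]
  exact Finset.le_sup (f := fun α => eLpNorm (weakDeriv D α u) ⊤ (volume.restrict D)) hα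

theorem eLpNorm_weakDeriv_le_sobolevENorm_two {d s : ℕ} (D : Set (Space d)) {α : Fin d → ℕ}
    (hα : α ∈ multiIndices d s) (u : Space d → ℝ) :
    eLpNorm (weakDeriv D α u) 2 (volume.restrict D) ≤ sobolevENorm D s 2 u := by
  rw [sobolevENorm, if_neg (by simp), one_div, ENNReal.le_rpow_inv_iff (by simp)]
  exact Finset.single_le_sum
    (f := fun α => eLpNorm (weakDeriv D α u) 2 (volume.restrict D) ^ (2 : ℝ≥0∞).toReal)
    (fun _ _ => zero_le) hα

theorem MemSobolev.sobolevENorm_top_ne_top {d s : ℕ} {D : Set (Space d)} (hD : IsOpen D)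
    {u : Space d → ℝ} (hu : MemSobolev D s ⊤ u) : sobolevENorm D s ⊤ u ≠ ⊤ := by
  rw [sobolevENorm, if_pos rfl, ← lt_top_iff_ne_top, Finset.sup_lt_iff (by simp)]
  exact fun α hα => (hu.memLp_weakDeriv hD hα).2

theorem MemSobolev.sobolevENorm_two_ne_top {d s : ℕ} {D : Set (Space d)} (hD : IsOpen D)
    {u : Space d → ℝ} (hu : MemSobolev D s 2 u) : sobolevENorm D s 2 u ≠ ⊤ := by
  rw [sobolevENorm, if_neg (by simp)]
  refine ENNReal.rpow_ne_top_of_nonneg (by simp) (ENNReal.sum_ne_top.2 fun α hα => ?_)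
  exact ENNReal.rpow_ne_top_of_nonneg (by simp) (hu.memLp_weakDeriv hD hα).2.ne

theorem MemSobolev.weakDeriv_zero_ae_eq {d s : ℕ} {D : Set (Space d)} (hD : IsOpen D)
    {p : ℝ≥0∞} {u : Space d → ℝ} (hu : MemSobolev D s p u) :
    weakDeriv D 0 u =ᵐ[volume.restrict D] u := by
  have h := hu.hasWeakDeriv (zero_mem_multiIndices d s)
  exact h.ae_eq hD (hasWeakDeriv_zero h.1)

theorem MemSobolev.eLpNorm_top_le {d s : ℕ} {D : Set (Space d)} (hD : IsOpen D)
    {u : Space d → ℝ} (hu : MemSobolev D s ⊤ u) :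
    eLpNorm u ⊤ (volume.restrict D) ≤ sobolevENorm D s ⊤ u := by
  rw [← eLpNorm_congr_ae (hu.weakDeriv_zero_ae_eq hD)]
  exact eLpNorm_weakDeriv_le_sobolevENorm_top D (zero_mem_multiIndices d s) u

theorem MemSobolev.eLpNorm_two_le {d s : ℕ} {D : Set (Space d)} (hD : IsOpen D)
    {u : Space d → ℝ} (hu : MemSobolev D s 2 u) :
    eLpNorm u 2 (volume.restrict D) ≤ sobolevENorm D s 2 u := by
  rw [← eLpNorm_congr_ae (hu.weakDeriv_zero_ae_eq hD)]
  exact eLpNorm_weakDeriv_le_sobolevENorm_two D (zero_mem_multiIndices d s) u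

/-! ### Bounds for the derivatives of mollified functions -/

theorem enorm_iteratedFDeriv_mollify_le {d k s : ℕ} (hk : k ≤ s) (φ : ContDiffBump (0 : Space d))
    {D : Set (Space d)} (hD : IsOpen D) {p : ℝ≥0∞} {u : Space d → ℝ} (hu : MemSobolev D s p u)
    (hi : IntegrableOn u D) {x : Space d} (hx : Metric.closedBall x φ.rOut ⊆ D) :
    ‖iteratedFDeriv ℝ k (mollify φ D u) x‖ₑ
      ≤ ∑ κ : Fin k → Fin d, ‖mollify φ D (weakDeriv D (countIndex κ) u) x‖ₑ := by
  have h1 := norm_iteratedFDeriv_le_sum (k := k) (contDiff_mollify φ hD.measurableSet hi) x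
  rw [← ofReal_norm]
  refine (ENNReal.ofReal_le_ofReal h1).trans ?_
  rw [ENNReal.ofReal_sum_of_nonneg fun _ _ => norm_nonneg _]
  refine Finset.sum_le_sum fun κ _ => ?_
  rw [ofReal_norm, multiDeriv_mollify φ hD.measurableSet hi
    (hu.hasWeakDeriv (countIndex_mem_multiIndices hk κ)) hx]

theorem enorm_iteratedFDeriv_mollify_le_sobolevENorm {d k s : ℕ} (hk : k ≤ s)
    (φ : ContDiffBump (0 : Space d)) {D : Set (Space d)} (hD : IsOpen D) {u : Space d → ℝ}
    (hu : MemSobolev D s ⊤ u) (hi : IntegrableOn u D) {x : Space d}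
    (hx : Metric.closedBall x φ.rOut ⊆ D) :
    ‖iteratedFDeriv ℝ k (mollify φ D u) x‖ₑ ≤ d ^ k * sobolevENorm D s ⊤ u := by
  refine (enorm_iteratedFDeriv_mollify_le hk φ hD hu hi hx).trans ?_
  refine (Finset.sum_le_card_nsmul _ _ (sobolevENorm D s ⊤ u) fun κ _ => ?_).trans ?_
  · exact (enorm_mollify_le_eLpNorm_top φ hD.measurableSet _ x).trans
      (eLpNorm_weakDeriv_le_sobolevENorm_top D (countIndex_mem_multiIndices hk κ) u)
  · simp

theorem eLpNorm_iteratedFDeriv_mollify_le {d k s : ℕ} (hk : k ≤ s)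
    (φ : ContDiffBump (0 : Space d)) {D : Set (Space d)} (hD : IsOpen D) {u : Space d → ℝ}
    (hu : MemSobolev D s 2 u) (hi : IntegrableOn u D) {E : Set (Space d)} (hE : MeasurableSet E)
    (hx : ∀ x ∈ E, Metric.closedBall x φ.rOut ⊆ D) :
    eLpNorm (iteratedFDeriv ℝ k (mollify φ D u)) 2 (volume.restrict E)
      ≤ d ^ k * sobolevENorm D s 2 u := by
  let F : (Fin k → Fin d) → Space d → ℝ := fun κ x =>
    ‖mollify φ D (weakDeriv D (countIndex κ) u) x‖
  have hwd : ∀ κ : Fin k → Fin d, MemLp (weakDeriv D (countIndex κ) u) 2 (volume.restrict D) :=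
    fun κ => hu.memLp_weakDeriv hD (countIndex_mem_multiIndices hk κ)
  have hF2 : ∀ κ, eLpNorm (F κ) 2 (volume.restrict E) ≤ sobolevENorm D s 2 u := by
    intro κ
    rw [eLpNorm_norm]
    exact (eLpNorm_mono_measure _ Measure.restrict_le_self).trans
      ((eLpNorm_two_mollify_le φ hD.measurableSet (hwd κ).1).trans
        (eLpNorm_weakDeriv_le_sobolevENorm_two D (countIndex_mem_multiIndices hk κ) u))
  have hFm : ∀ κ, AEStronglyMeasurable (F κ) (volume.restrict E) := by
    intro κ
    -- D is not assumed bounded here, so square integrability does not supply the integrability that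
    -- `contDiff_mollify` requires; measurability of a parameter integral is enough.
    have h1 : AEStronglyMeasurable
        (mollify φ D (weakDeriv D (countIndex κ) u)) volume := by
      refine AEStronglyMeasurable.integral_prod_right' (f := fun q : Space d × Space d =>
        φ.normed volume q.2 • D.indicator (weakDeriv D (countIndex κ) u) (q.1 - q.2)) ?_
      exact AEStronglyMeasurable.convolution_integrand (ContinuousLinearMap.lsmul ℝ ℝ)
        φ.continuous_normed.aestronglyMeasurable
        ((aestronglyMeasurable_indicator_iff hD.measurableSet).2 (hwd κ).1)
    exact h1.norm.mono_measure Measure.restrict_le_self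
  calc eLpNorm (iteratedFDeriv ℝ k (mollify φ D u)) 2 (volume.restrict E)
      ≤ eLpNorm (∑ κ, F κ) 2 (volume.restrict E) := by
        refine eLpNorm_mono_ae_real ?_
        filter_upwards [ae_restrict_mem hE] with x hxE
        have h1 := enorm_iteratedFDeriv_mollify_le hk φ hD hu hi (hx x hxE)
        simp_rw [← ofReal_norm] at h1
        rw [← ENNReal.ofReal_sum_of_nonneg fun _ _ => norm_nonneg _,
          ENNReal.ofReal_le_ofReal_iff (Finset.sum_nonneg fun _ _ => norm_nonneg _)] at h1
        rwa [Finset.sum_apply]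
    _ ≤ ∑ κ, eLpNorm (F κ) 2 (volume.restrict E) :=
        eLpNorm_sum_le (fun κ _ => hFm κ) (by norm_num)
    _ ≤ _ := by
        refine (Finset.sum_le_card_nsmul _ _ (sobolevENorm D s 2 u) fun κ _ => hF2 κ).trans ?_
        simp

/-- In the Leibniz sum the derivatives of w are taken in the sup norm and those of u in L². The
binomial coefficients add up to 2^k, which with d^k gives (2d)^k. -/
theorem eLpNorm_iteratedFDeriv_mul_mollify_le {d k s : ℕ} (hk : k ≤ s)
    (φ : ContDiffBump (0 : Space d)) {D : Set (Space d)} (hD : IsOpen D) {u w : Space d → ℝ}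
    (hu : MemSobolev D s 2 u) (hui : IntegrableOn u D)
    (hw : MemSobolev D s ⊤ w) (hwi : IntegrableOn w D)
    {E : Set (Space d)} (hE : MeasurableSet E)
    (hx : ∀ x ∈ E, Metric.closedBall x φ.rOut ⊆ D) :
    eLpNorm (iteratedFDeriv ℝ k fun x => mollify φ D w x * mollify φ D u x) 2 (volume.restrict E)
      ≤ (2 * d) ^ k * (sobolevENorm D s ⊤ w * sobolevENorm D s 2 u) := by
  set W := sobolevENorm D s ⊤ w
  have hW : W ≠ ⊤ := hw.sobolevENorm_top_ne_top hD
  have hws := contDiff_mollify φ hD.measurableSet hwi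
  have hus := contDiff_mollify φ hD.measurableSet hui
  let c : ℕ → ℝ := fun i => k.choose i * (d ^ i * W.toReal)
  have hc : ∀ i, ‖c i‖ₑ = k.choose i * (d ^ i * W) := by
    intro i
    rw [Real.enorm_of_nonneg (by positivity), ENNReal.ofReal_mul (by positivity),
      ENNReal.ofReal_mul (by positivity), ENNReal.ofReal_toReal hW,
      ENNReal.ofReal_pow (by positivity), ENNReal.ofReal_natCast, ENNReal.ofReal_natCast]
  let F : ℕ → Space d → ℝ := fun i =>
    c i • fun x => ‖iteratedFDeriv ℝ (k - i) (mollify φ D u) x‖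
  have hF : ∀ i ∈ Finset.range (k + 1), eLpNorm (F i) 2 (volume.restrict E)
      ≤ k.choose i * (d ^ k * (W * sobolevENorm D s 2 u)) := by
    intro i hi
    have hik : i ≤ k := Nat.lt_succ_iff.1 (Finset.mem_range.1 hi)
    rw [eLpNorm_const_smul, eLpNorm_norm, hc]
    refine (mul_le_mul' le_rfl (eLpNorm_iteratedFDeriv_mollify_le ((Nat.sub_le k i).trans hk)
      φ hD hu hui hE hx)).trans (le_of_eq ?_)
    have e : (d : ℝ≥0∞) ^ k = d ^ i * d ^ (k - i) := by rw [← pow_add, Nat.add_sub_cancel' hik]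
    rw [e]
    ring
  have hFm : ∀ i ∈ Finset.range (k + 1), AEStronglyMeasurable (F i) (volume.restrict E) := by
    intro i _
    have hle : ∀ j : ℕ, (j : WithTop ℕ∞) ≤ ((⊤ : ℕ∞) : WithTop ℕ∞) := fun j => by exact_mod_cast le_top
    exact ((hus.continuous_iteratedFDeriv (hle (k - i))).norm.const_smul
      (c i)).aestronglyMeasurable
  calc _ ≤ eLpNorm (∑ i ∈ Finset.range (k + 1), F i) 2 (volume.restrict E) := by
        refine eLpNorm_mono_ae_real ?_
        filter_upwards [ae_restrict_mem hE] with x hxE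
        refine (norm_iteratedFDeriv_mul_le hws hus x (by exact_mod_cast le_top)).trans ?_
        rw [Finset.sum_apply]
        refine Finset.sum_le_sum fun i hi => ?_
        have hik : i ≤ k := Nat.lt_succ_iff.1 (Finset.mem_range.1 hi)
        have h1 := enorm_iteratedFDeriv_mollify_le_sobolevENorm (hik.trans hk) φ hD hw hwi
          (hx x hxE)
        have h2 : ‖iteratedFDeriv ℝ i (mollify φ D w) x‖ ≤ d ^ i * W.toReal := by
          rw [← toReal_enorm]
          refine (ENNReal.toReal_mono (ENNReal.mul_ne_top (by simp) hW) h1).trans ?_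
          simp [W]
        simp only [F, c, Pi.smul_apply, smul_eq_mul]
        gcongr
    _ ≤ ∑ i ∈ Finset.range (k + 1), eLpNorm (F i) 2 (volume.restrict E) :=
        eLpNorm_sum_le hFm (by norm_num)
    _ ≤ ∑ i ∈ Finset.range (k + 1), (k.choose i : ℝ≥0∞) *
          (d ^ k * (W * sobolevENorm D s 2 u)) := Finset.sum_le_sum hF
    _ = _ := by
        rw [← Finset.sum_mul, ← Nat.cast_sum, Nat.sum_range_choose, mul_pow]
        push_cast
        ring

/-! ### Polynomial approximation in Sobolev spaces -/

/-- The set `E n` consists of the points whose ball of radius `ε n` stays in D. It inherits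
convexity, and there mollification at half that radius never sees the extension by zero. -/
theorem exists_mollifier_sequence {d : ℕ} {D : Set (Space d)} (hD : IsOpen D)
    (hc : Convex ℝ D) (hne : D.Nonempty) :
    ∃ (φ : ℕ → ContDiffBump (0 : Space d)) (E : ℕ → Set (Space d)) (B : Set (Space d)),
      (∀ n, Convex ℝ (E n)) ∧ (∀ n, MeasurableSet (E n)) ∧ (∀ n, E n ⊆ D) ∧
      (∀ x ∈ D, ∀ᶠ n in atTop, x ∈ E n) ∧ IsOpen B ∧ B.Nonempty ∧ (∀ n, B ⊆ E n) ∧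
      (∀ n, ∀ x ∈ E n, Metric.closedBall x (φ n).rOut ⊆ D) ∧
      ∀ u : Space d → ℝ, IntegrableOn u D → ∀ᵐ x ∂(volume.restrict D),
        Tendsto (fun n => mollify (φ n) D u x) atTop (𝓝 (u x)) := by
  obtain ⟨c, hcD⟩ := hne
  obtain ⟨ρ, hρ, hball⟩ := Metric.isOpen_iff.1 hD c hcD
  let ε : ℕ → ℝ := fun n => ρ / 2 * (1 / ((n : ℝ) + 1))
  have hε : ∀ n, 0 < ε n := fun n => by positivity
  have hεle : ∀ n, ε n ≤ ρ / 2 := fun n => by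
    refine mul_le_of_le_one_right (by positivity) ?_
    rw [div_le_one (by positivity)]
    linarith [(Nat.cast_nonneg n : (0 : ℝ) ≤ n)]
  have hε0 : Tendsto ε atTop (𝓝 0) := by
    have h0 := (tendsto_one_div_add_atTop_nhds_zero_nat (𝕜 := ℝ)).const_mul (ρ / 2)
    rwa [mul_zero] at h0
  -- The fixed ratio 2 of the radii is what Lebesgue differentiation needs for convergence almost
  -- everywhere.
  let φ : ℕ → ContDiffBump (0 : Space d) := fun n =>
    { rIn := ε n / 4, rOut := ε n / 2, rIn_pos := by linarith [hε n],
      rIn_lt_rOut := by linarith [hε n] }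
  refine ⟨φ, fun n => {x | Metric.ball x (ε n) ⊆ D}, Metric.ball c (ρ / 2), fun n => ?_,
    fun n => ?_, fun n x hx => hx (Metric.mem_ball_self (hε n)), fun x hx => ?_,
    Metric.isOpen_ball, ⟨c, Metric.mem_ball_self (by positivity)⟩, fun n x hx => ?_,
    fun n x hx => ?_, fun u hu => ?_⟩
  · intro x hx y hy a b ha hb hab z hz
    have hz' : z - (a • x + b • y) ∈ Metric.ball (0 : Space d) (ε n) := by
      rw [mem_ball_zero_iff, ← dist_eq_norm]
      exact hz
    have h1 : x + (z - (a • x + b • y)) ∈ D := hx (by simpa using hz')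
    have h2 : y + (z - (a • x + b • y)) ∈ D := hy (by simpa using hz')
    have h3 := hc h1 h2 ha hb hab
    have h4 : a • (x + (z - (a • x + b • y))) + b • (y + (z - (a • x + b • y))) = z := by
      have : b = 1 - a := by linarith
      subst this
      module
    rwa [h4] at h3
  · have h1 : {x | Metric.ball x (ε n) ⊆ D} = ⋂ z ∈ Dᶜ, {x | ε n ≤ dist z x} := by
      ext x
      simp only [Set.mem_ofPred_eq, Set.mem_iInter, Set.mem_compl_iff]
      constructor
      · intro h z hz
        by_contra! hlt
        exact hz (h hlt)
      · intro h z hz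
        by_contra hzD
        exact absurd (h z hzD) (not_le.2 hz)
    change MeasurableSet {x | Metric.ball x (ε n) ⊆ D}
    rw [h1]
    exact (isClosed_biInter fun z _ =>
      isClosed_le continuous_const (continuous_const.dist continuous_id)).measurableSet
  · obtain ⟨δ, hδ, hxδ⟩ := Metric.isOpen_iff.1 hD x hx
    filter_upwards [hε0.eventually (gt_mem_nhds hδ)] with n hn
    exact (Metric.ball_subset_ball hn.le).trans hxδ
  · refine (Metric.ball_subset_ball' ?_).trans hball
    linarith [hεle n, Metric.mem_ball.1 hx]
  · exact (Metric.closedBall_subset_ball (half_lt_self (hε n))).trans hx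
  · have hφ0 : Tendsto (fun n => (φ n).rOut) atTop (𝓝 0) := by
      simpa using hε0.div_const 2
    have h1 := ContDiffBump.ae_convolution_tendsto_right_of_locallyIntegrable (μ := volume)
      (K := 2) hφ0 (Eventually.of_forall fun n => by
        change ε n / 2 ≤ 2 * (ε n / 4)
        linarith)
      ((integrable_indicator_iff hD.measurableSet).2 hu).locallyIntegrable
    filter_upwards [ae_restrict_of_ae h1, ae_restrict_mem hD.measurableSet] with x hx hxD
    rw [Set.indicator_of_mem hxD] at hx
    exact hx

theorem exists_polyFun_approx_mul {d m : ℕ} {D : Set (Space d)} (hD : IsOpen D)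
    (hc : Convex ℝ D) (hne : D.Nonempty) (hb : Bornology.IsBounded D) {u w : Space d → ℝ}
    (hu : MemSobolev D (m + 1) 2 u) (hw : MemSobolev D (m + 1) ⊤ w) :
    ∃ p : MvPolynomial (Fin d) ℝ, p.totalDegree ≤ m ∧
      eLpNorm (fun x => w x * u x - polyFun p x) 2 (volume.restrict D)
        ≤ ENNReal.ofReal (Metric.diam D ^ (m + 1)) * (2 ^ d * ((2 * d) ^ (m + 1) *
          (sobolevENorm D (m + 1) ⊤ w * sobolevENorm D (m + 1) 2 u))) := by
  have hfin : IsFiniteMeasure (volume.restrict D) := ⟨by simpa using hb.measure_lt_top⟩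
  have hui : IntegrableOn u D := hu.1.integrable (by norm_num)
  have hwi : IntegrableOn w D := hw.1.integrable le_top
  have hN := ENNReal.mul_ne_top (hw.sobolevENorm_top_ne_top hD) (hu.sobolevENorm_two_ne_top hD)
  obtain ⟨φ, E, B, hEc, hEm, hED, hE, hBo, hBne, hBE, hφ, hlim⟩ :=
    exists_mollifier_sequence hD hc hne
  -- The L² bound `K'` is the derivative bound at order 0, whence the idle factor with exponent 0.
  refine exists_polyFun_approx_of_tendsto hb le_rfl hEc hEm hED hE hD.measurableSet hBo hBne hBE
    (gs := fun n x => mollify (φ n) D w x * mollify (φ n) D u x)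
    (K' := (2 * d) ^ 0 * (sobolevENorm D (m + 1) ⊤ w * sobolevENorm D (m + 1) 2 u))
    (fun n => (contDiff_mollify _ hD.measurableSet hwi).mul
      (contDiff_mollify _ hD.measurableSet hui)) ?_
    (ENNReal.mul_ne_top (by finiteness) hN) (ENNReal.mul_ne_top (by finiteness) hN)
    (fun n => eLpNorm_iteratedFDeriv_mul_mollify_le le_rfl (φ n) hD hu hui hw hwi (hEm n) (hφ n))
    fun n => ?_
  · filter_upwards [hlim w hwi, hlim u hui] with x h1 h2 using h1.mul h2
  · refine le_trans (le_of_eq ?_) (eLpNorm_iteratedFDeriv_mul_mollify_le (Nat.zero_le _) (φ n)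
      hD hu hui hw hwi (hEm n) (hφ n))
    exact eLpNorm_congr_norm_ae (Eventually.of_forall fun x => by
      rw [norm_iteratedFDeriv_zero])

/-- The degree m is decoupled from the smoothness s because w - q is needed with deg q ≤ N - M
although w has N + 1 derivatives. Sup bounds become L² bounds at the cost of √|D|. -/
theorem exists_polyFun_approx_of_memSobolev_top {d m s : ℕ} (hms : m + 1 ≤ s)
    {D : Set (Space d)} (hD : IsOpen D)
    (hc : Convex ℝ D) (hne : D.Nonempty) (hb : Bornology.IsBounded D) {w : Space d → ℝ}
    (hw : MemSobolev D s ⊤ w) :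
    ∃ p : MvPolynomial (Fin d) ℝ, p.totalDegree ≤ m ∧
      eLpNorm (fun x => w x - polyFun p x) 2 (volume.restrict D)
        ≤ ENNReal.ofReal (Metric.diam D ^ (m + 1)) * (2 ^ d * (d ^ (m + 1) *
          sobolevENorm D s ⊤ w * volume D ^ (1 / 2 : ℝ))) := by
  have hfin : IsFiniteMeasure (volume.restrict D) := ⟨by simpa using hb.measure_lt_top⟩
  have hwi : IntegrableOn w D := hw.1.integrable le_top
  have hN := hw.sobolevENorm_top_ne_top hD
  have hV : volume D ^ (1 / 2 : ℝ) ≠ ⊤ :=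
    ENNReal.rpow_ne_top_of_nonneg (by norm_num) hb.measure_lt_top.ne
  obtain ⟨φ, E, B, hEc, hEm, hED, hE, hBo, hBne, hBE, hφ, hlim⟩ :=
    exists_mollifier_sequence hD hc hne
  have key : ∀ k ≤ s, ∀ n, eLpNorm (iteratedFDeriv ℝ k (mollify (φ n) D w)) 2
      (volume.restrict (E n)) ≤ d ^ k * sobolevENorm D s ⊤ w * volume D ^ (1 / 2 : ℝ) := by
    intro k hk n
    rw [eLpNorm_two_le_iff]
    calc ∫⁻ x in E n, ‖iteratedFDeriv ℝ k (mollify (φ n) D w) x‖ₑ ^ 2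
        ≤ ∫⁻ _ in E n, (d ^ k * sobolevENorm D s ⊤ w) ^ 2 :=
          setLIntegral_mono' (hEm n) fun x hx => by
            gcongr
            exact enorm_iteratedFDeriv_mollify_le_sobolevENorm hk (φ n) hD hw hwi (hφ n x hx)
      _ = (d ^ k * sobolevENorm D s ⊤ w) ^ 2 * volume (E n) := setLIntegral_const _ _
      _ ≤ (d ^ k * sobolevENorm D s ⊤ w) ^ 2 * volume D := by
          gcongr
          exact hED n
      _ = _ := by
          rw [mul_pow _ (volume D ^ (1 / 2 : ℝ)), ← ENNReal.rpow_mul_natCast]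
          norm_num
  refine exists_polyFun_approx_of_tendsto hb le_rfl hEc hEm hED hE hD.measurableSet hBo hBne hBE
    (gs := fun n => mollify (φ n) D w)
    (K' := d ^ 0 * sobolevENorm D s ⊤ w * volume D ^ (1 / 2 : ℝ))
    (fun n => contDiff_mollify _ hD.measurableSet hwi) (hlim w hwi)
    (ENNReal.mul_ne_top (ENNReal.mul_ne_top (by finiteness) hN) hV)
    (ENNReal.mul_ne_top (ENNReal.mul_ne_top (by finiteness) hN) hV)
    (key _ hms) fun n => ?_
  refine le_trans (le_of_eq ?_) (key 0 (Nat.zero_le _) n)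
  exact eLpNorm_congr_norm_ae (Eventually.of_forall fun x => by
      rw [norm_iteratedFDeriv_zero])

/-! ### Elements -/

theorem isOpen_refSimplex (d : ℕ) : IsOpen (refSimplex d) := by
  have h1 : refSimplex d = (⋂ i, {x : Space d | -1 < x i}) ∩ {x | ∑ i, (x i + 1) < 2} := by
    ext x
    simp [refSimplex]
  rw [h1]
  exact (isOpen_iInter_of_finite fun i => isOpen_lt (by fun_prop) (by fun_prop)).inter
    (isOpen_lt (by fun_prop) (by fun_prop))

theorem convex_refSimplex (d : ℕ) : Convex ℝ (refSimplex d) := by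
  rintro x ⟨hx, hx'⟩ y ⟨hy, hy'⟩ a b ha hb hab
  have key : ∀ s t c : ℝ, s < c → t < c → a * s + b * t < c := by
    intro s t c hs ht
    rcases ha.eq_or_lt with rfl | ha
    · have : b = 1 := by linarith
      subst this
      linarith
    · obtain rfl : b = 1 - a := by linarith
      nlinarith [mul_pos ha (sub_pos.2 hs), mul_nonneg hb (sub_pos.2 ht).le]
  refine ⟨fun i => ?_, ?_⟩
  · have := key (-x i) (-y i) 1 (by linarith [hx i]) (by linarith [hy i])
    simp only [PiLp.add_apply, PiLp.smul_apply, smul_eq_mul]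
    linarith
  · have := key _ _ _ hx' hy'
    refine lt_of_eq_of_lt ?_ this
    rw [Finset.mul_sum, Finset.mul_sum, ← Finset.sum_add_distrib]
    refine Finset.sum_congr rfl fun i _ => ?_
    simp only [PiLp.add_apply, PiLp.smul_apply, smul_eq_mul]
    linear_combination -hab

theorem isBounded_refSimplex (d : ℕ) : Bornology.IsBounded (refSimplex d) := by
  let e : Space d ≃L[ℝ] (Fin d → ℝ) := EuclideanSpace.equiv (Fin d) ℝ
  have hK : IsCompact (e.symm '' Metric.closedBall (0 : Fin d → ℝ) 1) :=
    (isCompact_closedBall _ _).image e.symm.continuous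
  refine hK.isBounded.subset fun x hx => ⟨e x, ?_, e.symm_apply_apply x⟩
  rw [mem_closedBall_zero_iff, pi_norm_le_iff_of_nonneg zero_le_one]
  intro i
  have h1 : x i + 1 ≤ ∑ j, (x j + 1) :=
    Finset.single_le_sum (f := fun j => x j + 1) (fun j _ => by linarith [hx.1 j])
      (Finset.mem_univ i)
  change ‖x i‖ ≤ 1
  rw [Real.norm_eq_abs, abs_le]
  constructor <;> linarith [hx.1 i, hx.2]

theorem isOpen_element {d : ℕ} (Φ : Space d ≃ᵃ[ℝ] Space d) : IsOpen (element Φ) := by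
  have h1 : element Φ = Φ.symm ⁻¹' refSimplex d := Φ.toEquiv.image_eq_preimage_symm _
  rw [h1]
  exact (isOpen_refSimplex d).preimage Φ.symm.toAffineMap.continuous_of_finiteDimensional

theorem convex_element {d : ℕ} (Φ : Space d ≃ᵃ[ℝ] Space d) : Convex ℝ (element Φ) :=
  (convex_refSimplex d).affine_image Φ.toAffineMap

theorem isBounded_element {d : ℕ} (Φ : Space d ≃ᵃ[ℝ] Space d) :
    Bornology.IsBounded (element Φ) := by
  have h1 := (isBounded_refSimplex d).isCompact_closure.image
    Φ.toAffineMap.continuous_of_finiteDimensional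
  exact h1.isBounded.subset (Set.image_mono subset_closure)

theorem sqrt_volume_le {d : ℕ} {D : Set (Space d)} (hb : Bornology.IsBounded D) :
    √(volume.real D) ≤ √(volume.real (Metric.ball (0 : Space d) 1)) * √(Metric.diam D ^ d) := by
  rw [← Real.sqrt_mul measureReal_nonneg]
  refine Real.sqrt_le_sqrt ?_
  rcases D.eq_empty_or_nonempty with rfl | ⟨c, hc⟩
  · simp only [measureReal_empty, Metric.diam_empty]
    positivity
  have hsub : D ⊆ Metric.closedBall c (Metric.diam D) := fun x hx =>
    Metric.dist_le_diam_of_mem hb hx hc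
  have h1 : volume.real D ≤ volume.real (Metric.closedBall c (Metric.diam D)) :=
    measureReal_mono hsub (isCompact_closedBall _ _).measure_lt_top.ne
  refine h1.trans (le_of_eq ?_)
  rw [measureReal_def, Measure.addHaar_closedBall _ _ Metric.diam_nonneg, ENNReal.toReal_mul,
    ENNReal.toReal_ofReal (pow_nonneg Metric.diam_nonneg _), finrank_euclideanSpace_fin, mul_comm]
  rfl

/-! ### The norms `lpNorm` -/

theorem lpNorm_nonneg {d : ℕ} (D : Set (Space d)) (p : ℝ≥0∞) (f : Space d → ℝ) :
    0 ≤ lpNorm D p f := ENNReal.toReal_nonneg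

theorem ae_abs_le_lpNorm {d : ℕ} {D : Set (Space d)} {f : Space d → ℝ}
    (hf : MemLp f ⊤ (volume.restrict D)) :
    ∀ᵐ x ∂(volume.restrict D), |f x| ≤ lpNorm D ⊤ f := by
  filter_upwards [enorm_ae_le_eLpNormEssSup f (volume.restrict D)] with x hx
  rw [← Real.norm_eq_abs, ← toReal_enorm, lpNorm]
  refine ENNReal.toReal_mono hf.2.ne ?_
  rwa [eLpNorm_exponent_top]

theorem lpNorm_two_sq {d : ℕ} {D : Set (Space d)} {f : Space d → ℝ}
    (hf : MemLp f 2 (volume.restrict D)) : lpNorm D 2 f ^ 2 = ∫ x in D, f x * f x := by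
  rw [lpNorm, ← ENNReal.toReal_pow, eLpNorm_two_sq, integral_eq_lintegral_of_nonneg_ae
    (Eventually.of_forall fun x => mul_self_nonneg _) (hf.1.mul hf.1)]
  congr 1
  refine lintegral_congr fun x => ?_
  rw [← enorm_pow, Real.enorm_of_nonneg (by positivity), sq]

theorem abs_integral_mul_le {d : ℕ} {D : Set (Space d)} {f g : Space d → ℝ}
    (hf : MemLp f 2 (volume.restrict D)) (hg : MemLp g 2 (volume.restrict D)) :
    |∫ x in D, f x * g x| ≤ lpNorm D 2 f * lpNorm D 2 g := by
  have h1 := abs_real_inner_le_norm hg.toLp hf.toLp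
  rw [L2.inner_def, Lp.norm_toLp, Lp.norm_toLp, mul_comm] at h1
  refine le_trans (le_of_eq ?_) h1
  congr 1
  refine integral_congr_ae ?_
  filter_upwards [hf.coeFn_toLp, hg.coeFn_toLp] with x h2 h3
  rw [h2, h3]
  simp

theorem lpNorm_two_mul_le {d : ℕ} {D : Set (Space d)} {f g : Space d → ℝ}
    (hf : MemLp f ⊤ (volume.restrict D)) (hg : MemLp g 2 (volume.restrict D)) :
    lpNorm D 2 (fun x => f x * g x) ≤ lpNorm D ⊤ f * lpNorm D 2 g := by
  have h1 := eLpNorm_smul_le_eLpNorm_top_mul_eLpNorm (p := 2) hg.1 f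
  rw [lpNorm, lpNorm, lpNorm, ← ENNReal.toReal_mul]
  exact ENNReal.toReal_mono (ENNReal.mul_ne_top hf.2.ne hg.2.ne) h1

theorem lpNorm_two_le_lpNorm_top_mul {d : ℕ} {D : Set (Space d)} (hb : Bornology.IsBounded D)
    {f : Space d → ℝ} (hf : MemLp f ⊤ (volume.restrict D)) :
    lpNorm D 2 f ≤ lpNorm D ⊤ f * √(volume.real D) := by
  have h1 := eLpNorm_le_eLpNorm_mul_rpow_measure_univ (p := 2) (q := ⊤) le_top hf.1
  have h2 : (volume.restrict D Set.univ) ^ (1 / (2 : ℝ≥0∞).toReal - 1 / (⊤ : ℝ≥0∞).toReal)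
      = volume D ^ (1 / 2 : ℝ) := by simp
  rw [h2] at h1
  have h3 : volume D ^ (1 / 2 : ℝ) ≠ ⊤ :=
    ENNReal.rpow_ne_top_of_nonneg (by norm_num) hb.measure_lt_top.ne
  rw [Real.sqrt_eq_rpow, measureReal_def, ENNReal.toReal_rpow, lpNorm, lpNorm,
    ← ENNReal.toReal_mul]
  exact ENNReal.toReal_mono (ENNReal.mul_ne_top hf.2.ne h3) h1

theorem MemLp.mul_top_two {d : ℕ} {D : Set (Space d)} {f g : Space d → ℝ}
    (hf : MemLp f ⊤ (volume.restrict D)) (hg : MemLp g 2 (volume.restrict D)) :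
    MemLp (fun x => f x * g x) 2 (volume.restrict D) := by
  refine ⟨hf.1.mul hg.1, lt_of_le_of_lt
    (eLpNorm_smul_le_eLpNorm_top_mul_eLpNorm (p := 2) hg.1 f) ?_⟩
  exact ENNReal.mul_lt_top hf.2 hg.2

theorem integrable_mul_two {d : ℕ} {D : Set (Space d)} {f g : Space d → ℝ}
    (hf : MemLp f 2 (volume.restrict D)) (hg : MemLp g 2 (volume.restrict D)) :
    Integrable (fun x => f x * g x) (volume.restrict D) :=
  hf.integrable_mul hg

/-! ### The weighted projection -/

/-- The weighted form is positive definite on a finite-dimensional space, so the induced map into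
the dual is injective, hence bijective. -/
theorem existsUnique_isTInv {d N : ℕ} {D : Set (Space d)} (hD : IsOpen D) (hne : D.Nonempty)
    (hb : Bornology.IsBounded D) {a u : Space d → ℝ} (ha : MemLp a ⊤ (volume.restrict D))
    (hpos : ∀ᵐ x ∂(volume.restrict D), 0 < a x) (hu : MemLp u 2 (volume.restrict D)) :
    ∃! p : MvPolynomial (Fin d) ℝ, IsTInv D N a u p := by
  have hpoly : ∀ p : MvPolynomial (Fin d) ℝ, MemLp (polyFun p) 2 (volume.restrict D) :=
    fun p => memLp_of_continuous hb (continuous_polyFun p) 2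
  have hint : ∀ p q : MvPolynomial (Fin d) ℝ,
      Integrable (fun x => a x * polyFun p x * polyFun q x) (volume.restrict D) :=
    fun p q => integrable_mul_two (MemLp.mul_top_two ha (hpoly p)) (hpoly q)
  have hdef : ∀ p : MvPolynomial (Fin d) ℝ,
      ∫ x in D, a x * polyFun p x * polyFun p x = 0 → p = 0 := by
    intro p hp
    have hnn : 0 ≤ᵐ[volume.restrict D] fun x => a x * polyFun p x * polyFun p x := by
      filter_upwards [hpos] with x hx
      rw [mul_assoc]
      exact mul_nonneg hx.le (mul_self_nonneg _)
    rw [integral_eq_zero_iff_of_nonneg_ae hnn (hint p p)] at hp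
    refine eq_zero_of_ae_polyFun_eq_zero hD hne ?_
    filter_upwards [hp, hpos] with x h1 h2
    have h3 : a x * polyFun p x * polyFun p x = 0 := h1
    simpa [h2.ne'] using h3
  let V := MvPolynomial.restrictTotalDegree (Fin d) ℝ N
  let Bf : V →ₗ[ℝ] V →ₗ[ℝ] ℝ := LinearMap.mk₂ ℝ
    (fun p q => ∫ x in D, a x * polyFun (p : MvPolynomial (Fin d) ℝ) x * polyFun q x)
    (fun p p' q => by
      rw [← integral_add (hint _ _) (hint _ _)]
      congr 1
      funext x
      simp only [Submodule.coe_add, polyFun, map_add]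
      ring)
    (fun c p q => by
      rw [smul_eq_mul, ← integral_const_mul]
      congr 1
      funext x
      simp only [SetLike.val_smul, polyFun, MvPolynomial.smul_eval]
      ring)
    (fun p q q' => by
      rw [← integral_add (hint _ _) (hint _ _)]
      congr 1
      funext x
      simp only [Submodule.coe_add, polyFun, map_add]
      ring)
    (fun c p q => by
      rw [smul_eq_mul, ← integral_const_mul]
      congr 1
      funext x
      simp only [SetLike.val_smul, polyFun, MvPolynomial.smul_eval]
      ring)
  have hinj : Function.Injective Bf := by
    rw [injective_iff_map_eq_zero]
    intro p hp
    exact Subtype.ext (hdef p (LinearMap.congr_fun hp p))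
  have hsurj : Function.Surjective Bf :=
    (LinearMap.injective_iff_surjective_of_finrank_eq_finrank
      (Subspace.dual_finrank_eq (K := ℝ) (V := V)).symm).1 hinj
  let ℓ : V →ₗ[ℝ] ℝ :=
    { toFun := fun q => ∫ x in D, u x * polyFun (q : MvPolynomial (Fin d) ℝ) x
      map_add' := fun q q' => by
        rw [← integral_add (integrable_mul_two hu (hpoly _)) (integrable_mul_two hu (hpoly _))]
        congr 1
        funext x
        simp only [Submodule.coe_add, polyFun, map_add]
        ring
      map_smul' := fun c q => by
        rw [RingHom.id_apply, smul_eq_mul, ← integral_const_mul]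
        congr 1
        funext x
        simp only [SetLike.val_smul, polyFun, MvPolynomial.smul_eval]
        ring }
  have hmem : ∀ {q : MvPolynomial (Fin d) ℝ}, q.totalDegree ≤ N → q ∈ V := fun hq =>
    (MvPolynomial.mem_restrictTotalDegree _ _ _).2 hq
  obtain ⟨p, hp⟩ := hsurj ℓ
  refine ⟨p, ⟨(MvPolynomial.mem_restrictTotalDegree _ _ _).1 p.2, fun q hq =>
    LinearMap.congr_fun hp ⟨q, hmem hq⟩⟩, fun p' hp' => ?_⟩
  have h1 : Bf ⟨p', hmem hp'.1⟩ = Bf p := by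
    rw [hp]
    exact LinearMap.ext fun q =>
      hp'.2 q ((MvPolynomial.mem_restrictTotalDegree _ _ _).1 q.2)
  exact congrArg Subtype.val (hinj h1)

theorem isTInv_tInv {d N : ℕ} {D : Set (Space d)} {w u : Space d → ℝ}
    (h : ∃ p, IsTInv D N w u p) : IsTInv D N w u (tInv D N w u) := by
  rw [tInv, dif_pos h]
  exact h.choose_spec

/-! ### The error estimate -/

section Residual

variable {d N : ℕ} {D : Set (Space d)} {a w u : Space d → ℝ} {P : MvPolynomial (Fin d) ℝ}

theorem integral_residual_mul_eq_zero (hb : Bornology.IsBounded D)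
    (ha : MemLp a ⊤ (volume.restrict D)) (hu : MemLp u 2 (volume.restrict D))
    (hP : IsTInv D N a u P) {q : MvPolynomial (Fin d) ℝ} (hq : q.totalDegree ≤ N) :
    ∫ x in D, (u x - a x * polyFun P x) * polyFun q x = 0 := by
  have hpoly : ∀ p : MvPolynomial (Fin d) ℝ, MemLp (polyFun p) 2 (volume.restrict D) :=
    fun p => memLp_of_continuous hb (continuous_polyFun p) 2
  have h1 := hP.2 q hq
  unfold l2Inner at h1
  simp_rw [sub_mul]
  rw [integral_sub (integrable_mul_two hu (hpoly q))
    (integrable_mul_two (MemLp.mul_top_two ha (hpoly P)) (hpoly q)), h1, sub_self]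

/-- Galerkin orthogonality: any polynomial of degree at most N may be subtracted from the second
factor for free. -/
theorem integral_residual_mul_sub (hb : Bornology.IsBounded D)
    (ha : MemLp a ⊤ (volume.restrict D)) (hu : MemLp u 2 (volume.restrict D))
    (hP : IsTInv D N a u P) {q : MvPolynomial (Fin d) ℝ} (hq : q.totalDegree ≤ N)
    {g : Space d → ℝ} (hg : MemLp g 2 (volume.restrict D)) :
    ∫ x in D, (u x - a x * polyFun P x) * (g x - polyFun q x)
      = ∫ x in D, (u x - a x * polyFun P x) * g x := by
  have hpoly : ∀ p : MvPolynomial (Fin d) ℝ, MemLp (polyFun p) 2 (volume.restrict D) :=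
    fun p => memLp_of_continuous hb (continuous_polyFun p) 2
  have hr : MemLp (fun x => u x - a x * polyFun P x) 2 (volume.restrict D) :=
    hu.sub (MemLp.mul_top_two ha (hpoly P))
  simp_rw [mul_sub _ _ (polyFun q _)]
  rw [integral_sub (integrable_mul_two hr hg) (integrable_mul_two hr (hpoly q)),
    integral_residual_mul_eq_zero hb ha hu hP hq, sub_zero]

/-- Since r = a(wu - P), the product r(wu - P) = a(wu - P)² is nonnegative and r² ≤ ‖a‖_∞ r(wu - P)
pointwise. Under the integral, orthogonality exchanges P for q; Cauchy-Schwarz and division by ‖r‖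
finish. -/
theorem lpNorm_residual_le (hb : Bornology.IsBounded D)
    (ha : MemLp a ⊤ (volume.restrict D)) (hw : MemLp w ⊤ (volume.restrict D))
    (hpos : ∀ᵐ x ∂(volume.restrict D), 0 < a x)
    (haw : ∀ᵐ x ∂(volume.restrict D), a x * w x = 1) (hu : MemLp u 2 (volume.restrict D))
    (hP : IsTInv D N a u P) {q : MvPolynomial (Fin d) ℝ} (hq : q.totalDegree ≤ N) :
    lpNorm D 2 (fun x => u x - a x * polyFun P x)
      ≤ lpNorm D ⊤ a * lpNorm D 2 (fun x => w x * u x - polyFun q x) := by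
  have hpoly : ∀ p : MvPolynomial (Fin d) ℝ, MemLp (polyFun p) 2 (volume.restrict D) :=
    fun p => memLp_of_continuous hb (continuous_polyFun p) 2
  set r : Space d → ℝ := fun x => u x - a x * polyFun P x with hrdef
  have hr : MemLp r 2 (volume.restrict D) := hu.sub (MemLp.mul_top_two ha (hpoly P))
  have hwu : MemLp (fun x => w x * u x) 2 (volume.restrict D) := MemLp.mul_top_two hw hu
  have hsub : ∀ p : MvPolynomial (Fin d) ℝ,
      MemLp (fun x => w x * u x - polyFun p x) 2 (volume.restrict D) := fun p => hwu.sub (hpoly p)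
  have h1 : lpNorm D 2 r ^ 2 ≤ lpNorm D ⊤ a *
      (lpNorm D 2 r * lpNorm D 2 (fun x => w x * u x - polyFun q x)) := by
    calc lpNorm D 2 r ^ 2 = ∫ x in D, r x * r x := lpNorm_two_sq hr
      _ ≤ ∫ x in D, lpNorm D ⊤ a * (r x * (w x * u x - polyFun P x)) := by
          refine integral_mono_ae (integrable_mul_two hr hr)
            ((integrable_mul_two hr (hsub P)).const_mul _) ?_
          filter_upwards [hpos, haw, ae_abs_le_lpNorm ha] with x hx hxw hxa
          have e1 : r x = a x * (w x * u x - polyFun P x) := by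
            rw [hrdef]
            linear_combination (-u x) * hxw
          have e2 : r x * (w x * u x - polyFun P x) = a x * (w x * u x - polyFun P x) ^ 2 := by
            rw [e1]
            ring
          have e3 : r x * r x = a x * (r x * (w x * u x - polyFun P x)) := by
            conv_lhs => rw [e1]
            rw [e1]
            ring
          rw [e3]
          refine mul_le_mul_of_nonneg_right ((le_abs_self _).trans hxa) ?_
          rw [e2]
          exact mul_nonneg hx.le (sq_nonneg _)
      _ = lpNorm D ⊤ a * ∫ x in D, r x * (w x * u x - polyFun q x) := by
          rw [integral_const_mul, integral_residual_mul_sub hb ha hu hP hP.1 hwu,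
            integral_residual_mul_sub hb ha hu hP hq hwu]
      _ ≤ _ := by
          refine mul_le_mul_of_nonneg_left ?_ (lpNorm_nonneg _ _ _)
          exact (le_abs_self _).trans (abs_integral_mul_le hr (hsub q))
  rcases (lpNorm_nonneg D 2 r).eq_or_lt with h0 | h0
  · rw [← h0]
    exact mul_nonneg (lpNorm_nonneg _ _ _) (lpNorm_nonneg _ _ _)
  · refine le_of_mul_le_mul_left ?_ h0
    linarith

/-- The identity wu - P = wr moves the weight onto v, and the degree condition makes qv a polynomial
that r annihilates. -/
theorem abs_weightAdjusted_error_le (hb : Bornology.IsBounded D)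
    (ha : MemLp a ⊤ (volume.restrict D)) (hw : MemLp w ⊤ (volume.restrict D))
    (haw : ∀ᵐ x ∂(volume.restrict D), a x * w x = 1) (hu : MemLp u 2 (volume.restrict D))
    (hP : IsTInv D N a u P) {q v : MvPolynomial (Fin d) ℝ}
    (hqv : q.totalDegree + v.totalDegree ≤ N) :
    |l2Inner D (fun x => w x * u x) (polyFun v) - l2Inner D (polyFun P) (polyFun v)|
      ≤ lpNorm D 2 (fun x => u x - a x * polyFun P x) *
        (lpNorm D ⊤ (polyFun v) * lpNorm D 2 (fun x => w x - polyFun q x)) := by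
  have hpoly : ∀ p : MvPolynomial (Fin d) ℝ, MemLp (polyFun p) 2 (volume.restrict D) :=
    fun p => memLp_of_continuous hb (continuous_polyFun p) 2
  have hv : MemLp (polyFun v) ⊤ (volume.restrict D) :=
    memLp_of_continuous hb (continuous_polyFun v) ⊤
  have hfin : IsFiniteMeasure (volume.restrict D) := ⟨by simpa using hb.measure_lt_top⟩
  have hw2 : MemLp w 2 (volume.restrict D) := hw.mono_exponent le_top
  have hr : MemLp (fun x => u x - a x * polyFun P x) 2 (volume.restrict D) :=
    hu.sub (MemLp.mul_top_two ha (hpoly P))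
  have hwq : MemLp (fun x => w x - polyFun q x) 2 (volume.restrict D) := hw2.sub (hpoly q)
  have hvw : MemLp (fun x => polyFun v x * w x) 2 (volume.restrict D) := MemLp.mul_top_two hv hw2
  have h1 : l2Inner D (fun x => w x * u x) (polyFun v) - l2Inner D (polyFun P) (polyFun v)
      = ∫ x in D, (u x - a x * polyFun P x) * (polyFun v x * (w x - polyFun q x)) := by
    have e1 : ∀ x, polyFun v x * (w x - polyFun q x)
        = polyFun v x * w x - polyFun (q * v) x := by
      intro x
      rw [polyFun_mul]
      ring
    simp_rw [e1]
    rw [integral_residual_mul_sub hb ha hu hP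
      ((MvPolynomial.totalDegree_mul _ _).trans hqv) hvw, l2Inner, l2Inner,
      ← integral_sub (integrable_mul_two (MemLp.mul_top_two hw hu) (hpoly v))
        (integrable_mul_two (hpoly P) (hpoly v))]
    refine integral_congr_ae ?_
    filter_upwards [haw] with x hx
    linear_combination (polyFun P x * polyFun v x) * hx
  rw [h1]
  refine (abs_integral_mul_le hr (MemLp.mul_top_two hv hwq)).trans ?_
  exact mul_le_mul_of_nonneg_left (lpNorm_two_mul_le hv hwq) (lpNorm_nonneg _ _ _)

end Residual

theorem lpNorm_approx_mul_le {d m : ℕ} {D : Set (Space d)} (hD : IsOpen D)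
    (hc : Convex ℝ D) (hne : D.Nonempty) (hb : Bornology.IsBounded D) {u w : Space d → ℝ}
    (hu : MemSobolev D (m + 1) 2 u) (hw : MemSobolev D (m + 1) ⊤ w) :
    ∃ p : MvPolynomial (Fin d) ℝ, p.totalDegree ≤ m ∧
      lpNorm D 2 (fun x => w x * u x - polyFun p x)
        ≤ Metric.diam D ^ (m + 1) * (2 ^ d * ((2 * d) ^ (m + 1) *
          (sobolevNorm D (m + 1) ⊤ w * sobolevNorm D (m + 1) 2 u))) := by
  obtain ⟨p, hp, h1⟩ := exists_polyFun_approx_mul hD hc hne hb hu hw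
  refine ⟨p, hp, ?_⟩
  have hN := ENNReal.mul_ne_top (hw.sobolevENorm_top_ne_top hD) (hu.sobolevENorm_two_ne_top hD)
  have h2 := ENNReal.toReal_mono (ENNReal.mul_ne_top ENNReal.ofReal_ne_top
    (ENNReal.mul_ne_top (by finiteness) (ENNReal.mul_ne_top (by finiteness) hN))) h1
  simpa [ENNReal.toReal_mul, ENNReal.toReal_ofReal (pow_nonneg Metric.diam_nonneg (m + 1)),
    sobolevNorm, lpNorm] using h2

theorem lpNorm_approx_le {d m s : ℕ} (hms : m + 1 ≤ s) {D : Set (Space d)} (hD : IsOpen D)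
    (hc : Convex ℝ D) (hne : D.Nonempty) (hb : Bornology.IsBounded D) {w : Space d → ℝ}
    (hw : MemSobolev D s ⊤ w) :
    ∃ p : MvPolynomial (Fin d) ℝ, p.totalDegree ≤ m ∧
      lpNorm D 2 (fun x => w x - polyFun p x)
        ≤ Metric.diam D ^ (m + 1) * (2 ^ d * (d ^ (m + 1) *
          sobolevNorm D s ⊤ w * √(volume.real D))) := by
  obtain ⟨p, hp, h1⟩ := exists_polyFun_approx_of_memSobolev_top hms hD hc hne hb hw
  refine ⟨p, hp, ?_⟩
  have hV : volume D ^ (1 / 2 : ℝ) ≠ ⊤ :=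
    ENNReal.rpow_ne_top_of_nonneg (by norm_num) hb.measure_lt_top.ne
  have h2 := ENNReal.toReal_mono (ENNReal.mul_ne_top ENNReal.ofReal_ne_top
    (ENNReal.mul_ne_top (by finiteness) (ENNReal.mul_ne_top (ENNReal.mul_ne_top (by finiteness)
      (hw.sobolevENorm_top_ne_top hD)) hV))) h1
  rw [Real.sqrt_eq_rpow, measureReal_def, ENNReal.toReal_rpow]
  simpa [ENNReal.toReal_mul, ENNReal.toReal_ofReal (pow_nonneg Metric.diam_nonneg (m + 1)),
    sobolevNorm, lpNorm] using h2

/-- The constant of the error estimate. -/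
def errorConst (d N : ℕ) : ℝ :=
  ((2 ^ d * (2 * d) ^ (N + 1)) ^ 2 + 1) * √(volume.real (Metric.ball (0 : Space d) 1))

theorem errorConst_pos (d N : ℕ) : 0 < errorConst d N := by
  refine mul_pos (by positivity) (Real.sqrt_pos.2 ?_)
  exact ENNReal.toReal_pos (Metric.measure_ball_pos _ _ one_pos).ne'
    (Metric.isBounded_ball.measure_lt_top).ne

/-- In `errorConst`, the square pays for the two approximation estimates when h ≤ 1, and the summand
1 for the crude bound when h ≥ 1. -/
theorem abs_error_le {d N M : ℕ} (hd1 : 1 ≤ d) (hd4 : d ≤ 4) (hMN : M ≤ N) {D : Set (Space d)}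
    (hD : IsOpen D) (hc : Convex ℝ D) (hne : D.Nonempty) (hb : Bornology.IsBounded D)
    {u w : Space d → ℝ} (hu : MemSobolev D (N + 1) 2 u) (hw : MemSobolev D (N + 1) ⊤ w)
    {a : Space d → ℝ} (ha : MemLp a ⊤ (volume.restrict D))
    (hpos : ∀ᵐ x ∂(volume.restrict D), 0 < a x)
    (haw : ∀ᵐ x ∂(volume.restrict D), a x * w x = 1)
    {P : MvPolynomial (Fin d) ℝ} (hP : IsTInv D N a u P)
    {v : MvPolynomial (Fin d) ℝ} (hv : v.totalDegree ≤ M) :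
    |l2Inner D (fun x => w x * u x) (polyFun v) - l2Inner D (polyFun P) (polyFun v)|
      ≤ errorConst d N * Metric.diam D ^ (2 * N + 2 - M) * lpNorm D ⊤ w * lpNorm D ⊤ a ^ 2
        * sobolevNorm D (N + 1) ⊤ w ^ 2 * sobolevNorm D (N + 1) 2 u * lpNorm D ⊤ (polyFun v) := by
  set h := Metric.diam D with hh
  set A := lpNorm D ⊤ a
  set W := lpNorm D ⊤ w
  set V := lpNorm D ⊤ (polyFun v)
  set Wn := sobolevNorm D (N + 1) ⊤ w
  set S := sobolevNorm D (N + 1) 2 u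
  set c := √(volume.real (Metric.ball (0 : Space d) 1)) with hcdef
  set k : ℝ := 2 ^ d * (2 * d) ^ (N + 1) with hk
  have hh0 : 0 ≤ h := Metric.diam_nonneg
  have hA : 0 ≤ A := lpNorm_nonneg _ _ _
  have hW : 0 ≤ W := lpNorm_nonneg _ _ _
  have hV : 0 ≤ V := lpNorm_nonneg _ _ _
  have hWn : 0 ≤ Wn := ENNReal.toReal_nonneg
  have hS : 0 ≤ S := ENNReal.toReal_nonneg
  have hc0 : 0 ≤ c := Real.sqrt_nonneg _
  have hk0 : 0 ≤ k := by positivity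
  have hWWn : W ≤ Wn :=
    ENNReal.toReal_mono (hw.sobolevENorm_top_ne_top hD) (hw.eLpNorm_top_le hD)
  have huS : lpNorm D 2 u ≤ S :=
    ENNReal.toReal_mono (hu.sobolevENorm_two_ne_top hD) (hu.eLpNorm_two_le hD)
  -- As aw = 1 almost everywhere and D has positive measure, one point witnesses all three
  -- almost-everywhere statements.
  have hWA : 1 ≤ W * A := by
    have hne0 : NeZero (volume.restrict D) :=
      ⟨by simpa using (hD.measure_pos volume hne).ne'⟩
    obtain ⟨x, h1, h2, h3⟩ :=
      (haw.and ((ae_abs_le_lpNorm ha).and (ae_abs_le_lpNorm hw.1))).exists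
    calc (1 : ℝ) = |w x| * |a x| := by rw [← abs_mul, mul_comm, h1, abs_one]
      _ ≤ W * A := mul_le_mul h3 h2 (abs_nonneg _) hW
  have hvol : √(volume.real D) ≤ c * √(h ^ d) := sqrt_volume_le hb
  have hmain : |l2Inner D (fun x => w x * u x) (polyFun v) - l2Inner D (polyFun P) (polyFun v)|
      ≤ errorConst d N * h ^ (2 * N + 2 - M) * (A * Wn ^ 2 * S * V) := by
    rcases le_total h 1 with hle | hge
    · obtain ⟨p, hp, hp1⟩ := lpNorm_approx_mul_le hD hc hne hb hu hw
      obtain ⟨q, hq, hq1⟩ := lpNorm_approx_le (m := N - M) (s := N + 1) (by omega) hD hc hne hb hw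
      have hr := lpNorm_residual_le hb ha hw.1 hpos haw hu.1 hP hp
      have he := abs_weightAdjusted_error_le hb ha hw.1 haw hu.1 hP (q := q) (v := v) (by omega)
      have hsq : √(volume.real D) ≤ c := by
        refine hvol.trans (mul_le_of_le_one_right hc0 ?_)
        rw [Real.sqrt_le_one]
        exact pow_le_one₀ hh0 hle
      have hd1' : (1 : ℝ) ≤ d := by exact_mod_cast hd1
      have hkk : (2 : ℝ) ^ d * (d : ℝ) ^ (N - M + 1) ≤ k := by
        rw [hk]
        refine mul_le_mul_of_nonneg_left ?_ (by positivity)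
        calc (d : ℝ) ^ (N - M + 1) ≤ (2 * d) ^ (N - M + 1) := by
              gcongr
              linarith
          _ ≤ (2 * d) ^ (N + 1) := pow_le_pow_right₀ (by linarith) (by omega)
      have hq2 : lpNorm D 2 (fun x => w x - polyFun q x) ≤ h ^ (N - M + 1) * (k * Wn * c) := by
        refine hq1.trans ?_
        rw [← mul_assoc (2 ^ d : ℝ), ← mul_assoc (2 ^ d : ℝ)]
        gcongr
      have hp2 : lpNorm D 2 (fun x => w x * u x - polyFun p x) ≤ h ^ (N + 1) * (k * (Wn * S)) := by
        refine hp1.trans (le_of_eq ?_)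
        rw [hk]
        ring
      have hpow : h ^ (2 * N + 2 - M) = h ^ (N + 1) * h ^ (N - M + 1) := by
        rw [← pow_add]
        congr 1
        omega
      calc _ ≤ (A * (h ^ (N + 1) * (k * (Wn * S)))) * (V * (h ^ (N - M + 1) * (k * Wn * c))) := by
            refine he.trans (mul_le_mul (hr.trans ?_) ?_ ?_ ?_)
            · exact mul_le_mul_of_nonneg_left hp2 hA
            · exact mul_le_mul_of_nonneg_left hq2 hV
            · exact mul_nonneg hV (lpNorm_nonneg _ _ _)
            · positivity
        _ = k ^ 2 * c * h ^ (2 * N + 2 - M) * (A * Wn ^ 2 * S * V) := by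
            rw [hpow]
            ring
        _ ≤ _ := by
            unfold errorConst
            rw [← hcdef, ← hk]
            gcongr
            linarith
    -- For h ≥ 1 nothing is approximated: both polynomials are zero, and the power of h comes from
    -- √|D| alone.
    · have hr := lpNorm_residual_le hb ha hw.1 hpos haw hu.1 hP (q := 0) (by simp)
      have he := abs_weightAdjusted_error_le hb ha hw.1 haw hu.1 hP (q := 0) (v := v)
        (by simpa using hv.trans hMN)
      simp only [polyFun_zero, sub_zero] at hr he
      have h1 : lpNorm D 2 (fun x => w x * u x) ≤ Wn * S :=
        (lpNorm_two_mul_le hw.1 hu.1).trans (mul_le_mul hWWn huS (lpNorm_nonneg _ _ _) hWn)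
      -- This needs d ≤ 2(2N + 2 - M); since M ≤ N the right side is at least 4.
      have hsq : √(h ^ d) ≤ h ^ (2 * N + 2 - M) := by
        rw [Real.sqrt_le_left (by positivity), ← pow_mul]
        exact pow_le_pow_right₀ hge (by omega)
      have h2 : lpNorm D 2 w ≤ Wn * (c * h ^ (2 * N + 2 - M)) := by
        refine (lpNorm_two_le_lpNorm_top_mul hb hw.1).trans ?_
        refine mul_le_mul hWWn (hvol.trans ?_) (Real.sqrt_nonneg _) hWn
        exact mul_le_mul_of_nonneg_left hsq hc0
      calc _ ≤ (A * (Wn * S)) * (V * (Wn * (c * h ^ (2 * N + 2 - M)))) := by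
            refine he.trans (mul_le_mul (hr.trans ?_) ?_ ?_ ?_)
            · exact mul_le_mul_of_nonneg_left h1 hA
            · exact mul_le_mul_of_nonneg_left h2 hV
            · exact mul_nonneg hV (lpNorm_nonneg _ _ _)
            · positivity
        _ = 1 * c * h ^ (2 * N + 2 - M) * (A * Wn ^ 2 * S * V) := by ring
        _ ≤ _ := by
            unfold errorConst
            rw [← hcdef, ← hk]
            gcongr
            nlinarith [sq_nonneg k]
  have hCh : 0 ≤ errorConst d N * h ^ (2 * N + 2 - M) * (A * Wn ^ 2 * S * V) := by
    have := errorConst_pos d N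
    positivity
  calc _ ≤ errorConst d N * h ^ (2 * N + 2 - M) * (A * Wn ^ 2 * S * V) := hmain
    _ ≤ errorConst d N * h ^ (2 * N + 2 - M) * (A * Wn ^ 2 * S * V) * (W * A) :=
        le_mul_of_one_le_right hCh hWA
    _ = _ := by ring

theorem memLp_top_one_div {d : ℕ} {D : Set (Space d)} {w : Space d → ℝ}
    (hw : AEStronglyMeasurable w (volume.restrict D)) {c : ℝ} (hc : 0 < c)
    (hcw : ∀ᵐ x ∂(volume.restrict D), c ≤ w x) :
    MemLp (fun x => 1 / w x) ⊤ (volume.restrict D) := by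
  refine memLp_top_of_bound (hw.aemeasurable.const_div 1).aestronglyMeasurable (1 / c) ?_
  filter_upwards [hcw] with x hx
  rw [Real.norm_of_nonneg (by have := hc.trans_le hx; positivity)]
  exact one_div_le_one_div_of_le hc hx

end WADG

end

/-! ### The main theorem -/

theorem mainTheorem3 (d N : ℕ) (hd : d = 2 ∨ d = 3) (σ : ℝ) :
    ∃ C : ℝ, 0 < C ∧
      ∀ (Φ : WADG.Space d ≃ᵃ[ℝ] WADG.Space d) (D : Set (WADG.Space d)) (h : ℝ),
        D = WADG.element Φ → WADG.IsQuasiRegular σ D → h = Metric.diam D →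
      ∀ u w : WADG.Space d → ℝ,
        WADG.MemSobolev D (N + 1) 2 u →
        WADG.MemSobolev D (N + 1) ⊤ w →
        (∃ wmin wmax : ℝ, 0 < wmin ∧
          ∀ᵐ x ∂(MeasureTheory.volume.restrict D), wmin ≤ w x ∧ w x ≤ wmax) →
        -- the operator is well defined at `u`
        (∃! p : MvPolynomial (Fin d) ℝ, WADG.IsTInv D N (fun x => 1 / w x) u p) ∧
        -- the estimate for a test polynomial of degree at most `M`
        (∀ (M : ℕ) (v : MvPolynomial (Fin d) ℝ), M ≤ N → v.totalDegree ≤ M →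
          |WADG.l2Inner D (fun x => w x * u x) (WADG.polyFun v)
              - WADG.weightAdjustedInner D N w u (WADG.polyFun v)|
            ≤ C * h ^ (2 * N + 2 - M) * WADG.lpNorm D ⊤ w
                * WADG.lpNorm D ⊤ (fun x => 1 / w x) ^ 2
                * WADG.sobolevNorm D (N + 1) ⊤ w ^ 2
                * WADG.sobolevNorm D (N + 1) 2 u
                * WADG.lpNorm D ⊤ (WADG.polyFun v)) ∧
        -- the local conservation error
        |WADG.l2Inner D (fun x => w x * u x) (fun _ => 1)
            - WADG.weightAdjustedInner D N w u (fun _ => 1)|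
          ≤ C * h ^ (2 * N + 2) * WADG.lpNorm D ⊤ w
              * WADG.lpNorm D ⊤ (fun x => 1 / w x) ^ 2
              * WADG.sobolevNorm D (N + 1) ⊤ w ^ 2
              * WADG.sobolevNorm D (N + 1) 2 u := by
  refine ⟨WADG.errorConst d N, WADG.errorConst_pos d N, ?_⟩
  rintro Φ D h rfl ⟨c, r, hr, hball, -⟩ rfl u w hu hw ⟨wmin, wmax, hmin, hwb⟩
  have hD := WADG.isOpen_element Φ
  have hcv := WADG.convex_element Φ
  have hb := WADG.isBounded_element Φ
  have hne : (WADG.element Φ).Nonempty := ⟨c, hball (Metric.mem_ball_self hr)⟩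
  have ha := WADG.memLp_top_one_div hw.1.1 hmin (hwb.mono fun x hx => hx.1)
  have hpos : ∀ᵐ x ∂(MeasureTheory.volume.restrict (WADG.element Φ)), 0 < 1 / w x :=
    hwb.mono fun x hx => one_div_pos.2 (hmin.trans_le hx.1)
  have haw : ∀ᵐ x ∂(MeasureTheory.volume.restrict (WADG.element Φ)), 1 / w x * w x = 1 :=
    hwb.mono fun x hx => one_div_mul_cancel (hmin.trans_le hx.1).ne'
  have hex := WADG.existsUnique_isTInv (N := N) hD hne hb ha hpos hu.1
  have hP := WADG.isTInv_tInv hex.exists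
  have key : ∀ (M : ℕ) (v : MvPolynomial (Fin d) ℝ), M ≤ N → v.totalDegree ≤ M → _ :=
    fun M v hM hv => WADG.abs_error_le (by omega) (by omega) hM hD hcv hne hb hu hw ha hpos haw
      hP hv
  refine ⟨hex, key, ?_⟩
  have h1 := key 0 1 (Nat.zero_le N) (by simp)
  -- The sup norm of the constant 1 is 1 only because D has positive measure.
  have hone : WADG.lpNorm (WADG.element Φ) ⊤ (WADG.polyFun 1) = 1 := by
    rw [WADG.polyFun_one, WADG.lpNorm, MeasureTheory.eLpNorm_const _ (by simp)
      (by simpa using (hD.measure_pos MeasureTheory.volume hne).ne')]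
    simp
  rw [hone, mul_one, Nat.sub_zero, WADG.polyFun_one] at h1
  exact h1
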